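/- Let $d>1$ be a square-free integer and let $K=\mathbb Q(\sqrt d)$, a real quadratic field embedded in $\mathbb R$, with ring of integers $\mathcal O=\mathbb Z\oplus\omega\mathbb Z$, where $\omega=\sqrt d$ if $d\equiv 2,3 \bmod 4$ and $\omega=(1+\sqrt d)/2$ if $d\equiv 1\bmod 4$. Let $\beta\mapsto\overline\beta$ be the conjugation of $K$, $N(\beta)=\beta\overline\beta$ the norm, $U$ the unit group of $\mathcal O$, and $\epsilon$ a fundamental unit (so $U=\{\pm\epsilon^n:n\in\mathbb Z\}$). Let $\mathcal N=\{\beta\in K:N(\beta)=1\}$, let $\mathbb S=\mathbb R/(\mathbb Z\cdot\log|\epsilon^2|)$, and put $\varphi(\beta)=\log|\beta| \bmod \log|\epsilon^2|\in\mathbb S$ for $\beta\in\mathcal N$ and $\pi(z)=z/\overline z$ for $0\ne z\in K$. Let $\mathcal V=\{a+b\omega : a,b\in\mathbb Z,\ \gcd(a,b)=1\}$ be the set of visible points, and for $\gamma,\gamma'\in\mathcal O$ write $\gamma\sim\gamma'$ if there are a unit $\upsilon\in U$ and positive integers $m,n$ with $\upsilon m\gamma'=n\gamma$. Then for every $\xi\in\varphi(\mathcal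 N)$ there are two non-equivalent $\alpha,\alpha'\in\mathcal V$ with $\varphi(\pi(\alpha))=\varphi(\pi(\alpha'))=\xi$, and the number $$M(\xi)=\sqrt{|N(\alpha)N(\alpha')|}$$ does not depend on the choice of such $\alpha,\alpha'$. Put $\mathcal M(t)=\{\xi\in\varphi(\mathcal N): M(\xi)\le t\}$. Then $\mathcal M=\bigcup_{n\ge1}\mathcal M(n)$ is equidistributed in the compact group $\mathbb S$: the sets $\mathcal M(n)$ are finite and increasing in $n$, and for every continuous function $f:\mathbb S\to\mathbb C$, $$\lim_{n\to\infty}\frac{1}{\#\mathcal M(n)}\sum_{\xi\in\mathcal M(n)}f(\xi)=\int_{\mathbb S}f\,d\mu,$$ where $\mu$ is the normalized (probability) Haar measure on $\mathbb S$. -/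

import Mathlib

open scoped NumberField Topology

noncomputable section

/-- An increasing sequence `H 0 ⊆ H 1 ⊆ ⋯` of finite subsets of the compact abelian group `T`
(written additively) is equidistributed in `T`: for every continuous function `f` on `T` the averages
of `f` over `H n` tend to the integral of `f` against the normalized Haar measure of `T`
(the only Haar measure of `T` that is a probability measure). -/
def IsEquidistributed {T : Type*} [AddCommGroup T] [TopologicalSpace T] [MeasurableSpace T]
    (H : ℕ → Set T) : Prop :=
  CompactSpace T ∧ (∀ n, (H n).Finite) ∧ Monotone H ∧
    ∃ μ : MeasureTheory.Measure T, MeasureTheory.IsProbabilityMeasure μ ∧ μ.IsAddHaarMeasure ∧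
      ∀ f : C(T, ℂ),
        Filter.Tendsto (fun n : ℕ => (1 / ((H n).ncard : ℂ)) * ∑ᶠ b ∈ H n, f b)
          Filter.atTop (𝓝 (∫ x, f x ∂μ))

namespace RealQuadratic

/-- `ω = √d` if `d ≡ 2, 3 mod 4` and `ω = (1 + √d) / 2` if `d ≡ 1 mod 4`
(`δ` is the square root of `d` in `K`). -/
def omega {K : Type*} [Field K] (d : ℕ) (δ : K) : K :=
  if d % 4 = 1 then (1 + δ) / 2 else δ

/-- The visible points: the `a + b ω` with `a`, `b` relatively prime integers. -/
def visible {K : Type*} [Field K] (d : ℕ) (δ : K) : Set K :=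
  {α | ∃ a b : ℤ, Int.gcd a b = 1 ∧ α = (a : K) + (b : K) * omega d δ}

/-- The set `𝒩` of elements of norm one. -/
def normOne (K : Type*) [Field K] [NumberField K] : Set K :=
  {β | Algebra.norm ℚ β = 1}

/-- `ε` is a fundamental unit of a real quadratic field: the units are the `± ε ^ n`, `n ∈ ℤ`. -/
def IsFundamentalUnit {K : Type*} [Field K] (ε : (𝓞 K)ˣ) : Prop :=
  ∀ u : (𝓞 K)ˣ, ∃ n : ℤ, u = ε ^ n ∨ u = -ε ^ n

/-- `log |ε²|`, where `K` is embedded in `ℝ` by `ι`. -/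
def period {K : Type*} [Field K] (ι : K →+* ℝ) (ε : (𝓞 K)ˣ) : ℝ :=
  Real.log |ι (((ε : 𝓞 K) : K) ^ 2)|

/-- `φ(β) = log |β| mod log |ε²|`, an element of `𝕊 = ℝ / ℤ log |ε²|`. -/
def phi {K : Type*} [Field K] (ι : K →+* ℝ) (ε : (𝓞 K)ˣ) (β : K) : AddCircle (period ι ε) :=
  ((Real.log |ι β| : ℝ) : AddCircle (period ι ε))

/-- `π(z) = z / z̄`. -/
def piMap {K : Type*} [Field K] [NumberField K] (conj : K ≃ₐ[ℚ] K) (z : K) : K :=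
  z / conj z

/-- `γ ∼ γ'`: there are a unit `υ` and positive integers `m`, `n` with `υ m γ' = n γ`. -/
def RayEquiv {K : Type*} [Field K] (γ γ' : K) : Prop :=
  ∃ υ : (𝓞 K)ˣ, ∃ m n : ℕ, 0 < m ∧ 0 < n ∧ ((υ : 𝓞 K) : K) * (m : K) * γ' = (n : K) * γ

/-- `α`, `α'` are two non-equivalent visible points with `φ(π(α)) = φ(π(α')) = ξ`. -/
def IsPreimagePair {K : Type*} [Field K] [NumberField K] (d : ℕ) (δ : K) (conj : K ≃ₐ[ℚ] K)
    (ι : K →+* ℝ) (ε : (𝓞 K)ˣ) (ξ : AddCircle (period ι ε)) (α α' : K) : Prop :=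
  α ∈ visible d δ ∧ α' ∈ visible d δ ∧ ¬ RayEquiv α α' ∧
    phi ι ε (piMap conj α) = ξ ∧ phi ι ε (piMap conj α') = ξ

/-- `√|N(α) N(α')|`. -/
def pairNorm {K : Type*} [Field K] [NumberField K] (α α' : K) : ℝ :=
  Real.sqrt |((Algebra.norm ℚ α * Algebra.norm ℚ α' : ℚ) : ℝ)|

/-- `M(ξ) = √|N(α) N(α')|` for two non-equivalent visible points `α`, `α'` over `ξ`. (A choice of
such a pair is made here; that `M(ξ)` does not depend on it is part of the theorem.) -/
def M {K : Type*} [Field K] [NumberField K] (d : ℕ) (δ : K) (conj : K ≃ₐ[ℚ] K)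
    (ι : K →+* ℝ) (ε : (𝓞 K)ˣ) (ξ : AddCircle (period ι ε)) : ℝ :=
  Classical.epsilon fun r : ℝ => ∃ α α' : K,
    IsPreimagePair d δ conj ι ε ξ α α' ∧ r = pairNorm α α'

/-- `ℳ(t) = {ξ ∈ φ(𝒩) : M(ξ) ≤ t}`. -/
def MSet {K : Type*} [Field K] [NumberField K] (d : ℕ) (δ : K) (conj : K ≃ₐ[ℚ] K)
    (ι : K →+* ℝ) (ε : (𝓞 K)ˣ) (t : ℝ) : Set (AddCircle (period ι ε)) :=
  {ξ | ξ ∈ phi ι ε '' normOne K ∧ M d δ conj ι ε ξ ≤ t}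

end RealQuadratic

end

/-! By Hilbert 90 every element of norm one is z / z̄, and a rational factor turns z into a visible
point α, unique up to sign on its line. The point φ(π(α)) is the class of log |α / ᾱ| (`logRatio`),
a homomorphism on the nonzero elements of K with kernel the nonzero elements of ℚ ∪ ℚδ, sending ε to
`period`. Hence the visible points over ξ are, up to units, α and the visible point α' = δα / c,
where c is the content of δα (`eq_unit_mul_of_logRatio`); these are not equivalent because d is not
a square. Since c² |N(α')| = d |N(α)|, one gets M(ξ) = |N(α)| √d / c, and c divides d.

Exactly four visible points over ξ, namely ±α and ±α', satisfy 0 ≤ log |α / ᾱ| < |`period`| for a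
suitable α (`ncard_fiber`). Equidistribution thus reduces to a count, for each c dividing d, of the
visible α with content c, log |α / ᾱ| in [a, b) and |N(α)| ≤ T. It has to be asymptotic to a
constant times (b - a) T, with the constants not all zero.

In the plane of the two real embeddings this counts lattice points in a sector between hyperbolas.
The area is proportional to b - a, because diag(e^(s/2), e^(-s/2)) has determinant one, preserves xy
and shifts log |x / y| by s (`exists_volume_hyperbolicSector`). Möbius inversion passes from
lattices to visible points (`hasDensity_inter_visible`), and subtraction along the divisors of d
isolates one value of c (`exists_hasDensity_stratum`). -/

noncomputable section

open Filter Finset MeasureTheory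

/-! ### Equidistribution from counts in intervals -/

/-- Both the average and the integral are compared with a step function on N equal intervals; for
fixed N the step averages converge by hypothesis. The three errors are at most η / 4 each. -/
theorem tendsto_average_of_tendsto_Ico {ι : Type*} (F : ℕ → Finset ι) (x : ι → ℝ) {p : ℝ}
    (hp : 0 < p) (hx : ∀ n, ∀ i ∈ F n, x i ∈ Set.Ico 0 p)
    (h : ∀ a b, 0 ≤ a → a ≤ b → b ≤ p →
      Tendsto (fun n => (#{i ∈ F n | x i ∈ Set.Ico a b} : ℝ) / #(F n)) atTop (𝓝 ((b - a) / p)))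
    {f : ℝ → ℂ} (hf : Continuous f) :
    Tendsto (fun n => (1 / (#(F n) : ℂ)) * ∑ i ∈ F n, f (x i)) atTop
      (𝓝 ((1 / p : ℂ) * ∫ t in (0 : ℝ)..p, f t)) := by
  rw [Metric.tendsto_atTop']
  intro η hη
  have huc := (isCompact_Icc (a := (0 : ℝ)) (b := p)).uniformContinuousOn_of_continuous
    hf.continuousOn
  rw [Metric.uniformContinuousOn_iff] at huc
  obtain ⟨r, hr, huc⟩ := huc (η / 4) (by positivity)
  -- This makes the mesh p / N smaller than the modulus of continuity r.
  obtain ⟨N, hN⟩ := exists_nat_gt (p / r)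
  have hN0 : (0 : ℝ) < N := lt_trans (by positivity) hN
  have hNn : 0 < N := by exact_mod_cast hN0
  set s : ℝ := p / N with hs
  have hs0 : 0 < s := by positivity
  have hsr : s < r := by rw [hs, div_lt_iff₀ hN0]; rwa [div_lt_iff₀ hr, mul_comm] at hN
  have hNs : N * s = p := by rw [hs]; field_simp
  -- the step approximation
  have hclose : ∀ (j : ℕ) (t : ℝ), j < N → t ∈ Set.Icc (j * s) ((j + 1 : ℕ) * s) →
      ‖f t - f (j * s)‖ ≤ η / 4 := by
    intro j t hj ht
    have h1 : ((j + 1 : ℕ) : ℝ) * s ≤ p := by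
      rw [← hNs]; gcongr; exact_mod_cast hj
    have h0 : 0 ≤ (j : ℝ) * s := by positivity
    rw [← dist_eq_norm]
    refine (huc t ⟨h0.trans ht.1, ht.2.trans h1⟩ (j * s) ⟨h0, (ht.1.trans ht.2).trans h1⟩ ?_).le
    rw [Real.dist_eq, abs_of_nonneg (by linarith [ht.1])]
    have := ht.2
    push_cast at this
    linarith
  have hA : ∀ n, ‖(1 / (#(F n) : ℂ)) * ∑ i ∈ F n, f (x i) -
      ∑ j ∈ range N, (((#{i ∈ F n | x i ∈ Set.Ico (j * s) ((j + 1 : ℕ) * s)} : ℝ) / #(F n) : ℝ) : ℂ)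
        * f (j * s)‖ ≤ η / 4 := by
    intro n
    set J : ι → ℕ := fun i => ⌊x i / s⌋₊ with hJ
    have hmem : ∀ i ∈ F n, ∀ j : ℕ, J i = j ↔ x i ∈ Set.Ico (j * s) ((j + 1 : ℕ) * s) := by
      intro i hi j
      rw [hJ, Nat.floor_eq_iff (div_nonneg (hx n i hi).1 hs0.le), le_div_iff₀ hs0, div_lt_iff₀ hs0]
      push_cast
      rfl
    have hJN : ∀ i ∈ F n, J i ∈ range N := by
      intro i hi
      rw [mem_range, hJ, Nat.floor_lt (div_nonneg (hx n i hi).1 hs0.le), div_lt_iff₀ hs0, hNs]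
      exact (hx n i hi).2
    have e1 : ∑ j ∈ range N, (((#{i ∈ F n | x i ∈ Set.Ico (j * s) ((j + 1 : ℕ) * s)} : ℝ)
        / #(F n) : ℝ) : ℂ) * f (j * s) = (1 / (#(F n) : ℂ)) * ∑ i ∈ F n, f (J i * s) := by
      rw [← sum_fiberwise_of_maps_to hJN, mul_sum]
      refine sum_congr rfl fun j _ => ?_
      have e2 : ∑ i ∈ F n with J i = j, f (J i * s)
          = (#{i ∈ F n | x i ∈ Set.Ico (j * s) ((j + 1 : ℕ) * s)} : ℂ) * f (j * s) := by
        rw [filter_congr (fun i hi => hmem i hi j)]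
        refine Eq.trans ?_ ((sum_const (f (j * s))).trans (nsmul_eq_mul _ _))
        refine sum_congr rfl fun i hi => ?_
        rw [mem_filter] at hi
        rw [(hmem i hi.1 j).2 hi.2]
      rw [e2]
      push_cast
      ring
    rw [e1, ← mul_sub, ← sum_sub_distrib, norm_mul]
    have e3 : ‖∑ i ∈ F n, (f (x i) - f (J i * s))‖ ≤ #(F n) * (η / 4) := by
      rw [← nsmul_eq_mul]
      refine norm_sum_le_of_le _ (fun i hi => ?_) |>.trans (by rw [sum_const])
      have := (hmem i hi (J i)).1 rfl
      exact hclose _ _ (mem_range.1 (hJN i hi)) ⟨this.1, this.2.le⟩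
    -- For empty `F n` both averages vanish, division by zero being zero.
    rcases (Nat.eq_zero_or_pos #(F n)) with h0 | h0
    · simp [h0]; positivity
    · have h0' : (0 : ℝ) < #(F n) := by exact_mod_cast h0
      rw [norm_div, norm_one, Complex.norm_natCast, one_div, inv_mul_le_iff₀ h0']
      exact e3
  have hB : ‖(1 / p : ℂ) * (∫ t in (0 : ℝ)..p, f t) - ∑ j ∈ range N, ((1 / N : ℝ) : ℂ) * f (j * s)‖
      ≤ η / 4 := by
    have hadj := intervalIntegral.sum_integral_adjacent_intervals (μ := volume) (f := f)
      (a := fun j : ℕ => (j : ℝ) * s) (n := N) (fun k _ => hf.intervalIntegrable _ _)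
    simp only [Nat.cast_zero, zero_mul, hNs] at hadj
    have hpc : (p : ℂ) ≠ 0 := by exact_mod_cast hp.ne'
    have hNc : (N : ℂ) ≠ 0 := by exact_mod_cast hN0.ne'
    have e0 : ∑ j ∈ range N, ((1 / N : ℝ) : ℂ) * f (j * s)
        = (1 / p : ℂ) * ∑ j ∈ range N, ∫ t in (j * s : ℝ)..((j + 1 : ℕ) * s), f (j * s) := by
      rw [mul_sum]
      refine sum_congr rfl fun j _ => ?_
      rw [intervalIntegral.integral_const, show ((j + 1 : ℕ) : ℝ) * s - j * s = s by push_cast; ring,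
        Complex.real_smul, hs]
      push_cast
      field_simp
    rw [e0, ← hadj, ← mul_sub, ← sum_sub_distrib, norm_mul, norm_div, norm_one, Complex.norm_real,
      Real.norm_of_nonneg hp.le, one_div, inv_mul_le_iff₀ hp]
    calc _ ≤ ∑ j ∈ range N, η / 4 * s := ?_
      _ = p * (η / 4) := by rw [sum_const, card_range, nsmul_eq_mul, ← hNs]; ring
    refine norm_sum_le_of_le _ fun j hj => ?_
    rw [← intervalIntegral.integral_sub (hf.intervalIntegrable _ _) (by simp)]
    have hle : (j : ℝ) * s ≤ (j + 1 : ℕ) * s := by gcongr; simp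
    refine (intervalIntegral.norm_integral_le_of_norm_le_const (C := η / 4) fun t ht => ?_).trans ?_
    · rw [Set.uIoc_of_le hle] at ht
      exact hclose j t (mem_range.1 hj) ⟨ht.1.le, ht.2⟩
    · rw [abs_of_nonneg (by linarith), show ((j + 1 : ℕ) : ℝ) * s - j * s = s by push_cast; ring]
  have hC : Tendsto (fun n => ∑ j ∈ range N,
      (((#{i ∈ F n | x i ∈ Set.Ico (j * s) ((j + 1 : ℕ) * s)} : ℝ) / #(F n) : ℝ) : ℂ) * f (j * s))
      atTop (𝓝 (∑ j ∈ range N, ((1 / N : ℝ) : ℂ) * f (j * s))) := by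
    refine tendsto_finsetSum _ fun j hj => Tendsto.mul_const _ ?_
    refine (Complex.continuous_ofReal.tendsto _).comp ?_
    have hj1 : ((j + 1 : ℕ) : ℝ) * s ≤ p := by
      rw [← hNs]; gcongr; exact_mod_cast mem_range.1 hj
    convert! h (j * s) ((j + 1 : ℕ) * s) (by positivity) (by gcongr; simp) hj1 using 2
    rw [show ((j + 1 : ℕ) : ℝ) * s - j * s = s by push_cast; ring, hs]
    field_simp
  rw [Metric.tendsto_atTop'] at hC
  obtain ⟨n₀, hn₀⟩ := hC (η / 4) (by positivity)
  refine ⟨n₀, fun n hn => ?_⟩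
  have h1 := hn₀ n hn
  have h2 := hA n
  rw [← dist_eq_norm] at h2 hB
  rw [dist_comm] at hB
  refine (dist_triangle4 _ _ _ _).trans_lt (lt_of_le_of_lt (add_le_add (add_le_add h2 h1.le) hB) ?_)
  linarith

/-- When all fibres of `F n` over `S n` have the same size m, averaging over either set gives the
same value. The subgroup `H` is kept separate from its generator `p` because the circle in question
is defined by a period that may be negative, while `p` has to be positive. -/
theorem isEquidistributed_of_fibers (H : AddSubgroup ℝ) {p : ℝ} (hp : 0 < p)
    (hH : H = AddSubgroup.zmultiples p) (S : ℕ → Set (ℝ ⧸ H)) (hS : Monotone S)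
    {ι : Type*} (F : ℕ → Finset ι) (x : ι → ℝ) (hx : ∀ n, ∀ i ∈ F n, x i ∈ Set.Ico 0 p)
    (h : ∀ a b, 0 ≤ a → a ≤ b → b ≤ p →
      Tendsto (fun n => (#{i ∈ F n | x i ∈ Set.Ico a b} : ℝ) / #(F n)) atTop (𝓝 ((b - a) / p)))
    (m : ℕ) (hm : m ≠ 0) (hF : ∀ n, ∀ i ∈ F n, (x i : ℝ ⧸ H) ∈ S n)
    (hfib : ∀ n, ∀ ξ ∈ S n, {i | i ∈ F n ∧ (x i : ℝ ⧸ H) = ξ}.ncard = m) :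
    IsEquidistributed S := by
  classical
  subst hH
  have : Fact (0 < p) := ⟨hp⟩
  have himg : ∀ n, S n = ((F n).image fun i => (x i : AddCircle p) : Finset (AddCircle p)) := by
    intro n
    ext ξ
    simp only [coe_image, Set.mem_image, mem_coe]
    refine ⟨fun hξ => ?_, ?_⟩
    · have h1 := hfib n ξ hξ
      obtain ⟨i, hi⟩ := Set.nonempty_of_ncard_ne_zero (h1 ▸ hm)
      exact ⟨i, hi⟩
    · rintro ⟨i, hi, rfl⟩
      exact hF n i hi
  have hfib' : ∀ n, ∀ ξ ∈ (F n).image fun i => (x i : AddCircle p),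
      #{i ∈ F n | (x i : AddCircle p) = ξ} = m := by
    intro n ξ hξ
    rw [← hfib n ξ (by rw [himg n]; exact hξ), ← Set.ncard_coe_finset]
    congr 1
    ext i
    simp
  refine ⟨inferInstance, fun n => by rw [himg]; exact finite_toSet _, hS,
    AddCircle.haarAddCircle, inferInstance, inferInstance, fun f => ?_⟩
  have hint : ∫ ξ, f ξ ∂(AddCircle.haarAddCircle (T := p))
      = (1 / p : ℂ) * ∫ t in (0 : ℝ)..p, f (t : AddCircle p) := by
    have h1 := AddCircle.intervalIntegral_preimage p 0 (fun ξ => f ξ)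
    rw [zero_add] at h1
    rw [h1, AddCircle.volume_eq_smul_haarAddCircle, integral_smul_measure,
      ENNReal.toReal_ofReal hp.le, Complex.real_smul]
    have : (p : ℂ) ≠ 0 := by exact_mod_cast hp.ne'
    field_simp
  rw [hint]
  refine (tendsto_average_of_tendsto_Ico F x hp hx h
    (f.continuous.comp (AddCircle.continuous_mk' p))).congr fun n => ?_
  have hmaps : ∀ i ∈ F n, (x i : AddCircle p) ∈ (F n).image fun i => (x i : AddCircle p) :=
    fun i hi => mem_image_of_mem _ hi
  have hcard : #(F n) = m * #((F n).image fun i => (x i : AddCircle p)) := by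
    rw [card_eq_sum_card_fiberwise hmaps, sum_congr rfl (hfib' n), sum_const, smul_eq_mul, mul_comm]
  have hsum : ∑ i ∈ F n, f (x i : AddCircle p)
      = m * ∑ ξ ∈ (F n).image fun i => (x i : AddCircle p), f ξ := by
    rw [← sum_fiberwise_of_maps_to hmaps, mul_sum]
    refine sum_congr rfl fun ξ hξ => ?_
    rw [← hfib' n ξ hξ, ← nsmul_eq_mul, ← sum_const]
    refine sum_congr rfl fun i hi => ?_
    rw [(mem_filter.1 hi).2]
  have hmc : (m : ℂ) ≠ 0 := by exact_mod_cast hm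
  rw [himg n, finsum_mem_coe_finset, Set.ncard_coe_finset]
  change (1 / (#(F n) : ℂ)) * ∑ i ∈ F n, f (x i : AddCircle p) = _
  rw [hsum, hcard]
  push_cast
  rw [one_div, one_div, mul_inv]
  field_simp

/-! ### Area and lattice points of hyperbolic sectors -/

/-- The open double cone `a ≤ log |x / y| < b` in the plane. -/
def sector (a b : ℝ) : Set (Fin 2 → ℝ) :=
  {v | Real.exp a * |v 1| ≤ |v 0| ∧ |v 0| < Real.exp b * |v 1|}

/-- The part of the sector lying between the hyperbolas `x * y = ± T`. -/
def hyperbolicSector (a b T : ℝ) : Set (Fin 2 → ℝ) :=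
  {v ∈ sector a b | |v 0 * v 1| ≤ T}

theorem sector_ne_zero {a b : ℝ} {v : Fin 2 → ℝ} (hv : v ∈ sector a b) : v 0 ≠ 0 ∧ v 1 ≠ 0 := by
  have h1 : v 1 ≠ 0 := by
    intro h
    have := hv.2
    rw [h, abs_zero, mul_zero] at this
    exact absurd this (not_lt.2 (abs_nonneg _))
  refine ⟨fun h => ?_, h1⟩
  have := hv.1
  rw [h, abs_zero] at this
  have h2 := mul_pos (Real.exp_pos a) (abs_pos.2 h1)
  linarith

theorem mem_sector_iff {a b : ℝ} {v : Fin 2 → ℝ} (h0 : v 0 ≠ 0) (h1 : v 1 ≠ 0) :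
    v ∈ sector a b ↔ Real.log |v 0 / v 1| ∈ Set.Ico a b := by
  have h1' := abs_pos.2 h1
  rw [abs_div, Set.mem_Ico, Real.le_log_iff_exp_le (by positivity),
    Real.log_lt_iff_lt_exp (by positivity), le_div_iff₀ h1', div_lt_iff₀ h1']
  rfl

theorem isBounded_hyperbolicSector (a b T : ℝ) : Bornology.IsBounded (hyperbolicSector a b T) := by
  rw [isBounded_iff_forall_norm_le]
  -- The squares of the coordinates are at most e^b |T| and e^(-a) |T|, and x² ≤ A implies |x| ≤ 1 +
  -- A.
  refine ⟨1 + Real.exp b * |T| + Real.exp (-a) * |T|, fun v hv => ?_⟩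
  obtain ⟨⟨h1, h2⟩, h3⟩ := hv
  rw [abs_mul] at h3
  have h3 := h3.trans (le_abs_self T)
  have hb := Real.exp_pos b
  have ha := Real.exp_pos (-a)
  have hT := abs_nonneg T
  have e0 : |v 0| ^ 2 ≤ Real.exp b * |T| := by
    calc |v 0| ^ 2 = |v 0| * |v 0| := sq _
      _ ≤ |v 0| * (Real.exp b * |v 1|) := by gcongr
      _ = Real.exp b * (|v 0| * |v 1|) := by ring
      _ ≤ _ := by gcongr
  have e1 : |v 1| ^ 2 ≤ Real.exp (-a) * |T| := by
    calc |v 1| ^ 2 = Real.exp (-a) * ((Real.exp a * |v 1|) * |v 1|) := by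
          rw [Real.exp_neg]; field_simp
      _ ≤ Real.exp (-a) * (|v 0| * |v 1|) := by gcongr
      _ ≤ _ := by gcongr
  have p0 : 0 ≤ Real.exp b * |T| := by positivity
  have p1 : 0 ≤ Real.exp (-a) * |T| := by positivity
  rw [pi_norm_le_iff_of_nonneg (by positivity)]
  intro i
  fin_cases i
  · change ‖v 0‖ ≤ _
    rw [Real.norm_eq_abs]; nlinarith [abs_nonneg (v 0)]
  · change ‖v 1‖ ≤ _
    rw [Real.norm_eq_abs]; nlinarith [abs_nonneg (v 1)]

theorem measurableSet_hyperbolicSector (a b T : ℝ) : MeasurableSet (hyperbolicSector a b T) := by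
  have c0 : Measurable fun v : Fin 2 → ℝ => |v 0| := by fun_prop
  have c1 : Measurable fun v : Fin 2 → ℝ => |v 1| := by fun_prop
  have c2 : Measurable fun v : Fin 2 → ℝ => |v 0 * v 1| := by fun_prop
  exact ((measurableSet_le (c1.const_mul _) c0).inter (measurableSet_lt c0 (c1.const_mul _))).inter
    (measurableSet_le c2 measurable_const)

theorem volume_eq_zero_of_countable_slices {s : Set (Fin 2 → ℝ)} (hs : MeasurableSet s)
    (h : ∀ x : ℝ, {y : ℝ | ![x, y] ∈ s}.Countable) : volume s = 0 := by
  have hmp := (volume_preserving_finTwoArrow ℝ).symm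
  rw [← hmp.measure_preimage hs.nullMeasurableSet, Measure.volume_eq_prod,
    Measure.measure_prod_null (hmp.measurable hs)]
  exact Eventually.of_forall fun x => (h x).measure_zero _

theorem countable_setOf_abs_eq (c : ℝ) : {y : ℝ | |y| = c}.Countable := by
  refine (Set.toFinite {c, -c}).countable.mono fun y hy => ?_
  rcases abs_choice y with h | h
  · left; rw [← hy, h]
  · right; rw [← hy, h]; simp

theorem volume_setOf_abs_eq_zero {c : ℝ} (hc : 0 < c) :
    volume {v : Fin 2 → ℝ | c * |v 1| = |v 0|} = 0 := by
  refine volume_eq_zero_of_countable_slices ?_ fun x => ?_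
  · exact measurableSet_eq_fun (by fun_prop) (by fun_prop)
  · refine (countable_setOf_abs_eq (|x| / c)).mono fun y hy => ?_
    have hy : c * |y| = |x| := hy
    simp only [Set.mem_ofPred_eq]
    rw [← hy]; field_simp

theorem volume_hyperbola_eq_zero : volume {v : Fin 2 → ℝ | |v 0 * v 1| = 1} = 0 := by
  refine volume_eq_zero_of_countable_slices ?_ fun x => ?_
  · exact measurableSet_eq_fun (by fun_prop) (by fun_prop)
  · refine (countable_setOf_abs_eq (1 / |x|)).mono fun y hy => ?_
    have hy : |x * y| = 1 := hy
    simp only [Set.mem_ofPred_eq]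
    rw [abs_mul] at hy
    have : |x| ≠ 0 := fun h => by simp [h] at hy
    field_simp
    linarith

/-- The boundary lies on two pairs of lines and a hyperbola, whose vertical slices are countable. A
null boundary is what the lattice point count requires. -/
theorem volume_frontier_hyperbolicSector (a b : ℝ) :
    volume (frontier (hyperbolicSector a b 1)) = 0 := by
  have c0 : Continuous fun v : Fin 2 → ℝ => |v 0| := by fun_prop
  have c1 : Continuous fun v : Fin 2 → ℝ => |v 1| := by fun_prop
  have c2 : Continuous fun v : Fin 2 → ℝ => |v 0 * v 1| := by fun_prop
  have hsub : frontier (hyperbolicSector a b 1) ⊆ ({v | Real.exp a * |v 1| = |v 0|} ∪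
      {v | Real.exp b * |v 1| = |v 0|}) ∪ {v | |v 0 * v 1| = 1} := by
    intro v hv
    have hv : v ∈ frontier (({v : Fin 2 → ℝ | Real.exp a * |v 1| ≤ |v 0|} ∩
      {v | |v 0| < Real.exp b * |v 1|}) ∩ {v | |v 0 * v 1| ≤ 1}) := hv
    rcases frontier_inter_subset _ _ hv with h | h
    · rcases frontier_inter_subset _ _ h.1 with h | h
      · exact Or.inl (Or.inl (frontier_le_subset_eq (c1.const_mul _) c0 h.1))
      · exact Or.inl (Or.inr (frontier_lt_subset_eq c0 (c1.const_mul _) h.2).symm)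
    · exact Or.inr (frontier_le_subset_eq c2 continuous_const h.2)
  refine measure_mono_null hsub ?_
  rw [measure_union_null_iff, measure_union_null_iff]
  exact ⟨⟨volume_setOf_abs_eq_zero (Real.exp_pos a), volume_setOf_abs_eq_zero (Real.exp_pos b)⟩,
    volume_hyperbola_eq_zero⟩

/-- The image of Lebesgue measure on `|x * y| ≤ 1` under `log |x / y|`. -/
def sectorMeasure : Measure ℝ :=
  (volume.restrict {v : Fin 2 → ℝ | v 0 ≠ 0 ∧ v 1 ≠ 0 ∧ |v 0 * v 1| ≤ 1}).map
    fun v => Real.log |v 0 / v 1|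

theorem sectorMeasure_apply {E : Set ℝ} (hE : MeasurableSet E) :
    sectorMeasure E = volume {v : Fin 2 → ℝ | Real.log |v 0 / v 1| ∈ E ∧
      v 0 ≠ 0 ∧ v 1 ≠ 0 ∧ |v 0 * v 1| ≤ 1} := by
  have hm : Measurable fun v : Fin 2 → ℝ => Real.log |v 0 / v 1| := by fun_prop
  rw [sectorMeasure, Measure.map_apply hm hE, Measure.restrict_apply (hm hE)]
  rfl

theorem sectorMeasure_Ico (a b : ℝ) :
    sectorMeasure (Set.Ico a b) = volume (hyperbolicSector a b 1) := by
  rw [sectorMeasure_apply measurableSet_Ico]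
  congr 1
  ext v
  constructor
  · rintro ⟨h1, h2, h3, h4⟩
    exact ⟨(mem_sector_iff h2 h3).2 h1, h4⟩
  · rintro ⟨h1, h4⟩
    have h := sector_ne_zero h1
    exact ⟨(mem_sector_iff h.1 h.2).1 h1, h.1, h.2, h4⟩

/-- The map diag(e^(s/2), e^(-s/2)) preserves area and the product xy, and it translates log |x / y|
by s. -/
instance : sectorMeasure.IsAddLeftInvariant := by
  refine ⟨fun s => ?_⟩
  ext E hE
  rw [Measure.map_apply (measurable_const_add s) hE, sectorMeasure_apply hE,
    sectorMeasure_apply (measurable_const_add s hE)]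
  set D : Fin 2 → ℝ := ![Real.exp (s / 2), Real.exp (-(s / 2))] with hD
  have hdet : (Matrix.diagonal D).det = 1 := by
    rw [Matrix.det_diagonal, Fin.prod_univ_two]
    simp [hD, ← Real.exp_add]
  have hmap := Real.smul_map_diagonal_volume_pi (D := D) (by rw [hdet]; exact one_ne_zero)
  rw [hdet, abs_one, ENNReal.ofReal_one, one_smul] at hmap
  have hme : MeasurableSet {v : Fin 2 → ℝ | Real.log |v 0 / v 1| ∈ E ∧
      v 0 ≠ 0 ∧ v 1 ≠ 0 ∧ |v 0 * v 1| ≤ 1} := by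
    have hm : Measurable fun v : Fin 2 → ℝ => Real.log |v 0 / v 1| := by fun_prop
    have m0 : Measurable fun v : Fin 2 → ℝ => v 0 := by fun_prop
    have m1 : Measurable fun v : Fin 2 → ℝ => v 1 := by fun_prop
    have m2 : Measurable fun v : Fin 2 → ℝ => |v 0 * v 1| := by fun_prop
    exact (hm hE).inter ((m0 (measurableSet_singleton 0).compl).inter
      ((m1 (measurableSet_singleton 0).compl).inter (measurableSet_le m2 measurable_const)))
  conv_rhs => rw [← hmap]
  rw [Measure.map_apply (by fun_prop) hme]
  congr 1
  ext v
  simp only [Set.mem_preimage, Set.mem_ofPred_eq, Matrix.toLin'_apply, Matrix.mulVec_diagonal]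
  have e0 : D 0 = Real.exp (s / 2) := rfl
  have e1 : D 1 = Real.exp (-(s / 2)) := rfl
  have p0 := Real.exp_pos (s / 2)
  rw [e0, e1]
  have e2 : Real.exp (s / 2) * v 0 * (Real.exp (-(s / 2)) * v 1) = v 0 * v 1 := by
    rw [Real.exp_neg]; field_simp
  have e3 : Real.exp (s / 2) * v 0 / (Real.exp (-(s / 2)) * v 1) = Real.exp s * (v 0 / v 1) := by
    have : Real.exp s = Real.exp (s / 2) * Real.exp (s / 2) := by rw [← Real.exp_add]; ring_nf
    rw [Real.exp_neg, this]
    by_cases h : v 1 = 0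
    · simp [h]
    · field_simp
  rw [e2, e3]
  have hne : ∀ y : ℝ, Real.exp (s / 2) * y ≠ 0 ↔ y ≠ 0 := fun y => by simp
  have hne' : ∀ y : ℝ, Real.exp (-(s / 2)) * y ≠ 0 ↔ y ≠ 0 := fun y => by simp
  rw [hne, hne']
  refine and_congr_left fun h => ?_
  have : |v 0 / v 1| ≠ 0 := by simp [h.1, h.2.1]
  rw [abs_mul, Real.abs_exp, Real.log_mul (Real.exp_pos s).ne' this, Real.log_exp]

instance : IsFiniteMeasureOnCompacts sectorMeasure := by
  refine ⟨fun {C} hC => ?_⟩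
  obtain ⟨R, hR⟩ := (isBounded_iff_forall_norm_le.1 hC.isBounded)
  have hsub : C ⊆ Set.Ico (-R) (R + 1) := fun x hx => by
    have := abs_le.1 (hR x hx)
    exact ⟨this.1, by linarith [this.2]⟩
  refine (measure_mono hsub).trans_lt ?_
  rw [sectorMeasure_Ico]
  exact (isBounded_hyperbolicSector _ _ _).measure_lt_top

/-- Uniqueness of Haar measure on ℝ makes `sectorMeasure` a multiple of Lebesgue measure, so no area
has to be computed. The factor is positive because the sector over [0, 1) contains a nonempty open
set. -/
theorem exists_volume_hyperbolicSector : ∃ c : ℝ, 0 < c ∧ ∀ a b : ℝ, a ≤ b →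
    volume.real (hyperbolicSector a b 1) = c * (b - a) := by
  set c := sectorMeasure.addHaarScalarFactor volume
  have hc : sectorMeasure = c • volume := Measure.isAddLeftInvariant_eq_smul _ _
  have key : ∀ a b : ℝ, a ≤ b → volume.real (hyperbolicSector a b 1) = c * (b - a) := by
    intro a b hab
    rw [measureReal_def, ← sectorMeasure_Ico, hc]
    rw [Measure.smul_apply, Real.volume_Ico, ENNReal.smul_def, smul_eq_mul, ENNReal.toReal_mul,
      ENNReal.toReal_ofReal (sub_nonneg.2 hab)]
    rfl
  refine ⟨c, ?_, key⟩
  have h := key 0 1 zero_le_one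
  rw [sub_zero, mul_one] at h
  rw [← h]
  have c0 : Continuous fun v : Fin 2 → ℝ => |v 0| := by fun_prop
  have c1 : Continuous fun v : Fin 2 → ℝ => |v 1| := by fun_prop
  have c2 : Continuous fun v : Fin 2 → ℝ => |v 0 * v 1| := by fun_prop
  have hopen : IsOpen ({v : Fin 2 → ℝ | |v 1| < |v 0|} ∩ {v | |v 0| < Real.exp 1 * |v 1|} ∩
      {v | |v 0 * v 1| < 1}) :=
    ((isOpen_lt c1 c0).inter (isOpen_lt c0 (c1.const_mul _))).inter (isOpen_lt c2 continuous_const)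
  refine ENNReal.toReal_pos (ne_of_gt ?_) (isBounded_hyperbolicSector _ _ _).measure_lt_top.ne
  -- The point (1, 1/2) lies in the open set because e > 2.
  refine lt_of_lt_of_le (hopen.measure_pos volume ⟨![1, 1 / 2], ?_⟩) (measure_mono ?_)
  · have := Real.exp_one_gt_d9
    refine ⟨⟨?_, ?_⟩, ?_⟩
    · simp; norm_num
    · simp [abs_of_pos]; linarith
    · simp; norm_num
  · rintro v ⟨⟨h1, h2⟩, h3⟩
    have h1 : |v 1| < |v 0| := h1
    exact ⟨⟨by rw [Real.exp_zero, one_mul]; exact h1.le, h2⟩, le_of_lt h3⟩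

/-- The sector is a cone and |xy| is homogeneous of degree two, so the count divided by T tends to
area over covolume. The constant κ is the same for all intervals. -/
theorem exists_tendsto_card_hyperbolicSector_inter (L : Submodule ℤ (Fin 2 → ℝ))
    [DiscreteTopology L] [IsZLattice ℝ L] : ∃ κ : ℝ, 0 < κ ∧ ∀ a b : ℝ, a ≤ b →
      Tendsto (fun T : ℝ => ((hyperbolicSector a b T ∩ L).ncard : ℝ) / T) atTop
        (𝓝 (κ * (b - a))) := by
  obtain ⟨c, hc, hvol⟩ := exists_volume_hyperbolicSector
  refine ⟨c / ZLattice.covolume L, div_pos hc (ZLattice.covolume_pos L volume), fun a b hab => ?_⟩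
  have := ZLattice.covolume.tendsto_card_le_div L (X := sector a b) (F := fun v => |v 0 * v 1|)
    ?_ ?_ (isBounded_hyperbolicSector a b 1) (measurableSet_hyperbolicSector a b 1)
    (volume_frontier_hyperbolicSector a b)
  · convert! this using 2
    rw [div_mul_eq_mul_div, ← hvol a b hab]
    rfl
  · rintro v r ⟨h1, h2⟩ hr
    constructor
    · simp only [Pi.smul_apply, smul_eq_mul, abs_mul, abs_of_pos hr]
      calc _ = r * (Real.exp a * |v 1|) := by ring
        _ ≤ _ := by gcongr
    · simp only [Pi.smul_apply, smul_eq_mul, abs_mul, abs_of_pos hr]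
      calc _ < r * (Real.exp b * |v 1|) := by gcongr
        _ = _ := by ring
  · intro v r hr
    simp only [Pi.smul_apply, smul_eq_mul, abs_mul, abs_of_nonneg hr, Fintype.card_fin]
    ring

/-! ### Arithmetic of the quadratic field and its order ℤ ⊕ ωℤ -/

namespace RealQuadratic

/-- `K = ℚ(δ)` is quadratic, where `δ ^ 2 = d` for a square-free `d > 1`, and `conj` is the
nontrivial automorphism. -/
structure IsRealQuadratic {K : Type*} [Field K] [NumberField K] (d : ℕ) (δ : K)
    (conj : K ≃ₐ[ℚ] K) : Prop where
  finrank_eq : Module.finrank ℚ K = 2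
  squarefree : Squarefree d
  one_lt : 1 < d
  sq_eq : δ ^ 2 = (d : K)
  conj_eq : conj δ = -δ

namespace IsRealQuadratic

variable {K : Type*} [Field K] [NumberField K] {d : ℕ} {δ : K} {conj : K ≃ₐ[ℚ] K}

theorem not_isSquare (h : IsRealQuadratic d δ conj) : ¬ IsSquare d := by
  rintro ⟨r, hr⟩
  have h1 := h.squarefree r (dvd_of_eq hr.symm)
  rw [Nat.isUnit_iff] at h1
  have := h.one_lt
  rw [hr, h1] at this
  omega

theorem rat_sq_ne (h : IsRealQuadratic d δ conj) (q : ℚ) : q ^ 2 ≠ d := by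
  intro hq
  refine h.not_isSquare ?_
  rw [← Rat.isSquare_natCast_iff]
  exact ⟨q, by rw [← hq, sq]⟩

theorem delta_ne_zero (h : IsRealQuadratic d δ conj) : δ ≠ 0 := by
  intro h0
  have h1 := h.sq_eq
  rw [h0, sq, zero_mul] at h1
  have := h.one_lt
  have h2 : d = 0 := by exact_mod_cast h1.symm
  omega

theorem rat_add_mul_eq_zero (h : IsRealQuadratic d δ conj) {x y : ℚ}
    (hxy : (x : K) + y * δ = 0) : x = 0 ∧ y = 0 := by
  have hy : y = 0 := by
    by_contra hy
    refine h.rat_sq_ne (x / y) ?_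
    have hy' : (y : K) ≠ 0 := by exact_mod_cast hy
    have h1 : δ = -(x / y : K) := by field_simp; linear_combination hxy
    have h2 := h.sq_eq
    rw [h1, neg_sq] at h2
    exact_mod_cast h2
  subst hy
  simpa using hxy

theorem linearIndependent (h : IsRealQuadratic d δ conj) :
    LinearIndependent ℚ ![(1 : K), δ] := by
  rw [LinearIndependent.pair_iff]
  intro s t hst
  refine h.rat_add_mul_eq_zero ?_
  rw [← hst, Algebra.smul_def, Algebra.smul_def]
  simp

/-- The basis `1, δ`. -/
def basis (h : IsRealQuadratic d δ conj) : Module.Basis (Fin 2) ℚ K :=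
  basisOfLinearIndependentOfCardEqFinrank h.linearIndependent (by rw [h.finrank_eq]; rfl)

theorem basis_zero (h : IsRealQuadratic d δ conj) : h.basis 0 = 1 := by simp [basis]

theorem basis_one (h : IsRealQuadratic d δ conj) : h.basis 1 = δ := by simp [basis]

theorem eq_repr (h : IsRealQuadratic d δ conj) (z : K) :
    z = (h.basis.repr z 0 : K) + (h.basis.repr z 1 : K) * δ := by
  have h1 := h.basis.sum_repr z
  rw [Fin.sum_univ_two, basis_zero, basis_one, Algebra.smul_def, Algebra.smul_def] at h1
  conv_lhs => rw [← h1]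
  simp

theorem exists_rat (h : IsRealQuadratic d δ conj) (z : K) : ∃ x y : ℚ, z = (x : K) + y * δ :=
  ⟨_, _, h.eq_repr z⟩

theorem repr_eq (h : IsRealQuadratic d δ conj) (x y : ℚ) :
    h.basis.repr ((x : K) + y * δ) 0 = x ∧ h.basis.repr ((x : K) + y * δ) 1 = y := by
  have h1 := h.eq_repr ((x : K) + y * δ)
  set u := h.basis.repr ((x : K) + y * δ) 0
  set v := h.basis.repr ((x : K) + y * δ) 1
  have h2 := h.rat_add_mul_eq_zero (x := u - x) (y := v - y) (by
    push_cast; linear_combination -h1)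
  exact ⟨sub_eq_zero.1 h2.1, sub_eq_zero.1 h2.2⟩

theorem conj_rat (x : ℚ) : conj (x : K) = x := map_ratCast conj x

theorem conj_apply (h : IsRealQuadratic d δ conj) (x y : ℚ) :
    conj ((x : K) + y * δ) = (x : K) - y * δ := by
  rw [map_add, map_mul, conj_rat, conj_rat, h.conj_eq]; ring

theorem conj_conj (h : IsRealQuadratic d δ conj) (z : K) : conj (conj z) = z := by
  obtain ⟨x, y, rfl⟩ := h.exists_rat z
  have := h.conj_apply x (-y)
  push_cast at this
  rw [h.conj_apply, sub_eq_add_neg, ← neg_mul, this]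
  ring

theorem norm_eq (h : IsRealQuadratic d δ conj) (z : K) :
    ((Algebra.norm ℚ z : ℚ) : K) = z * conj z := by
  obtain ⟨x, y, rfl⟩ := h.exists_rat z
  have e1 : ((x : K) + y * δ) * δ = ((d * y : ℚ) : K) + (x : ℚ) * δ := by
    push_cast; linear_combination (y : K) * h.sq_eq
  rw [Algebra.norm_eq_matrix_det h.basis, Matrix.det_fin_two]
  simp only [Algebra.leftMulMatrix_eq_repr_mul, basis_zero, basis_one, mul_one, e1, h.repr_eq]
  rw [h.conj_apply]
  push_cast
  linear_combination (y : K) ^ 2 * h.sq_eq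

theorem norm_real (h : IsRealQuadratic d δ conj) (ι : K →+* ℝ) (z : K) :
    ((Algebra.norm ℚ z : ℚ) : ℝ) = ι z * ι (conj z) := by
  rw [← map_mul, ← h.norm_eq, map_ratCast]

theorem eq_or_eq_of_conj (h : IsRealQuadratic d δ conj) {z : K}
    (hz : z = conj z ∨ z = -conj z) : ∃ q : ℚ, z = q ∨ z = q * δ := by
  obtain ⟨x, y, rfl⟩ := h.exists_rat z
  rw [h.conj_apply] at hz
  rcases hz with hz | hz
  · have := h.rat_add_mul_eq_zero (x := 0) (y := 2 * y) (by push_cast; linear_combination hz)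
    have hy : y = 0 := by linarith [this.2]
    exact ⟨x, Or.inl (by rw [hy]; simp)⟩
  · have := h.rat_add_mul_eq_zero (x := 2 * x) (y := 0) (by push_cast; linear_combination hz)
    have hx : x = 0 := by linarith [this.1]
    exact ⟨y, Or.inr (by rw [hx]; simp)⟩

theorem mod_four (h : IsRealQuadratic d δ conj) : d % 4 ≠ 0 := by
  intro h0
  have := h.squarefree 2 (by omega)
  rw [Nat.isUnit_iff] at this
  omega

/-- The quadratic equation of `ω`, its conjugate, and `δ` in terms of `ω`. -/
theorem omega_spec (h : IsRealQuadratic d δ conj) : ∃ t n k r : ℤ,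
    omega d δ * omega d δ = t * omega d δ - n ∧ conj (omega d δ) = t - omega d δ ∧
      δ = r + k * omega d δ ∧ k ≠ 0 := by
  unfold omega
  split_ifs with h1
  · have h4 : d = 4 * (d / 4) + 1 := by omega
    have h4' : (d : K) = 4 * ((d / 4 : ℕ) : K) + 1 := by exact_mod_cast congrArg (Nat.cast (R := K)) h4
    -- Here `d / 4` is integer division, so n = (1 - d) / 4 is the norm of ω.
    refine ⟨1, -((d / 4 : ℕ) : ℤ), 2, -1, ?_, ?_, ?_, by norm_num⟩
    · have := h.sq_eq
      rw [h4'] at this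
      rw [Int.cast_neg, Int.cast_natCast, Int.cast_one]
      linear_combination this / 4
    · rw [map_div₀, map_add, map_one, h.conj_eq, map_ofNat]
      push_cast; ring
    · push_cast; ring
  · refine ⟨0, -(d : ℤ), 1, 0, ?_, ?_, ?_, by norm_num⟩
    · have := h.sq_eq
      push_cast; linear_combination this
    · rw [h.conj_eq]; push_cast; ring
    · push_cast; ring

theorem rat_add_mul_omega_eq_zero (h : IsRealQuadratic d δ conj) {x y : ℚ}
    (hxy : (x : K) + y * omega d δ = 0) : x = 0 ∧ y = 0 := by
  obtain ⟨t, n, k, r, -, -, h3, hk⟩ := h.omega_spec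
  have hkK : (k : K) ≠ 0 := by exact_mod_cast hk
  have h4 := h.rat_add_mul_eq_zero (x := k * x - y * r) (y := y) (by
    rw [h3]; push_cast; linear_combination (k : K) * hxy)
  have hkq : (k : ℚ) ≠ 0 := by exact_mod_cast hk
  have hx := h4.1
  rw [h4.2, zero_mul, sub_zero] at hx
  exact ⟨(mul_eq_zero.1 hx).resolve_left hkq, h4.2⟩

theorem int_omega_inj (h : IsRealQuadratic d δ conj) {a b a' b' : ℤ}
    (hab : (a : K) + b * omega d δ = a' + b' * omega d δ) : a = a' ∧ b = b' := by
  have h1 := h.rat_add_mul_omega_eq_zero (x := a - a') (y := b - b') (by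
    push_cast; linear_combination hab)
  constructor
  · exact_mod_cast sub_eq_zero.1 h1.1
  · exact_mod_cast sub_eq_zero.1 h1.2

theorem exists_rat_omega (h : IsRealQuadratic d δ conj) (z : K) :
    ∃ x y : ℚ, z = (x : K) + y * omega d δ := by
  obtain ⟨x, y, rfl⟩ := h.exists_rat z
  obtain ⟨t, n, k, r, -, -, h3, -⟩ := h.omega_spec
  refine ⟨x + y * r, y * k, ?_⟩
  push_cast
  linear_combination (y : K) * h3

/-- The ring `ℤ ⊕ ωℤ`. -/
def order (h : IsRealQuadratic d δ conj) : Subring K where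
  carrier := {z | ∃ a b : ℤ, z = (a : K) + (b : K) * omega d δ}
  mul_mem' := by
    rintro _ _ ⟨a, b, rfl⟩ ⟨a', b', rfl⟩
    obtain ⟨t, n, k, r, h1, -⟩ := h.omega_spec
    refine ⟨a * a' - b * b' * n, a * b' + a' * b + b * b' * t, ?_⟩
    push_cast
    linear_combination (b * b' : K) * h1
  one_mem' := ⟨1, 0, by simp⟩
  add_mem' := by
    rintro _ _ ⟨a, b, rfl⟩ ⟨a', b', rfl⟩
    exact ⟨a + a', b + b', by push_cast; ring⟩
  zero_mem' := ⟨0, 0, by simp⟩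
  neg_mem' := by
    rintro _ ⟨a, b, rfl⟩
    exact ⟨-a, -b, by push_cast; ring⟩

theorem mem_order_iff (h : IsRealQuadratic d δ conj) {z : K} :
    z ∈ h.order ↔ ∃ a b : ℤ, z = (a : K) + (b : K) * omega d δ := Iff.rfl

theorem visible_subset_order (h : IsRealQuadratic d δ conj) {z : K} (hz : z ∈ visible d δ) :
    z ∈ h.order := by
  obtain ⟨a, b, -, rfl⟩ := hz
  exact ⟨a, b, rfl⟩

theorem delta_mem (h : IsRealQuadratic d δ conj) : δ ∈ h.order := by
  obtain ⟨t, n, k, r, -, -, h3, -⟩ := h.omega_spec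
  exact ⟨r, k, h3⟩

theorem conj_mem (h : IsRealQuadratic d δ conj) {z : K} (hz : z ∈ h.order) :
    conj z ∈ h.order := by
  obtain ⟨a, b, rfl⟩ := hz
  obtain ⟨t, n, k, r, -, h2, -⟩ := h.omega_spec
  refine ⟨a + b * t, -b, ?_⟩
  rw [map_add, map_mul, h2, map_intCast, map_intCast]
  push_cast; ring

theorem exists_int_of_rat_mem (h : IsRealQuadratic d δ conj) {q : ℚ} (hq : (q : K) ∈ h.order) :
    ∃ m : ℤ, q = m := by
  obtain ⟨a, b, hab⟩ := hq
  have h1 := h.rat_add_mul_omega_eq_zero (x := q - a) (y := -b) (by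
    push_cast; linear_combination hab)
  exact ⟨a, sub_eq_zero.1 h1.1⟩

theorem exists_int_norm (h : IsRealQuadratic d δ conj) {z : K} (hz : z ∈ h.order) :
    ∃ m : ℤ, Algebra.norm ℚ z = m := by
  refine h.exists_int_of_rat_mem ?_
  rw [h.norm_eq]
  exact h.order.mul_mem hz (h.conj_mem hz)

theorem delta_isIntegral (h : IsRealQuadratic d δ conj) : IsIntegral ℤ δ := by
  refine IsIntegral.of_pow two_pos ?_
  rw [h.sq_eq]
  simpa using isIntegral_algebraMap (R := ℤ) (A := K) (x := (d : ℤ))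

theorem exists_int_of_isIntegral {q : ℚ} (hq : IsIntegral ℤ (q : K)) : ∃ m : ℤ, q = m := by
  have h1 : IsIntegral ℤ q := (isIntegral_algebraMap_iff (algebraMap ℚ K).injective).1 (by simpa using hq)
  obtain ⟨m, hm⟩ := IsIntegrallyClosed.isIntegral_iff.1 h1
  exact ⟨m, by simpa using hm.symm⟩

/-- The trace 2x, the norm, and δ(z - z̄) = 2dy are integers; square-freeness of d then makes 2y an
integer, and a congruence modulo 4 settles the parities. Its purpose is that units of `𝓞 K` lie in
`order`. -/
theorem mem_order_of_isIntegral (h : IsRealQuadratic d δ conj) {z : K} (hz : IsIntegral ℤ z) :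
    z ∈ h.order := by
  have hc : IsIntegral ℤ (conj z) := map_isIntegral_int (conj : K →+* K) hz
  obtain ⟨N, hN⟩ := exists_int_of_isIntegral (K := K) (q := Algebra.norm ℚ z) (by
    rw [h.norm_eq]; exact hz.mul hc)
  have hNK := h.norm_eq z
  rw [hN] at hNK
  obtain ⟨x, y, rfl⟩ := h.exists_rat z
  rw [h.conj_apply] at hc hNK
  obtain ⟨m, hm⟩ := exists_int_of_isIntegral (K := K) (q := 2 * x) (by
    have e : (((2 * x : ℚ)) : K) = (x + y * δ) + (x - y * δ) := by push_cast; ring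
    rw [e]; exact hz.add hc)
  obtain ⟨w, hw⟩ := exists_int_of_isIntegral (K := K) (q := 2 * d * y) (by
    have e : (((2 * d * y : ℚ)) : K) = δ * ((x + y * δ) - (x - y * δ)) := by
      push_cast; linear_combination (-2 * y : K) * h.sq_eq
    rw [e]; exact h.delta_isIntegral.mul (hz.sub hc))
  have hNq : x ^ 2 - d * y ^ 2 = N := by
    have h1 : (((x ^ 2 - d * y ^ 2 : ℚ)) : K) = ((N : ℚ) : K) := by
      push_cast at hNK ⊢; linear_combination -hNK + (y : K) ^ 2 * h.sq_eq
    exact_mod_cast h1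
  have hd0 : (d : ℚ) ≠ 0 := by have := h.one_lt; positivity
  have hdw : (d : ℤ) * (m ^ 2 - 4 * N) = w ^ 2 := by
    have : (d : ℚ) * (m ^ 2 - 4 * N) = w ^ 2 := by rw [← hm, ← hw, ← hNq]; ring
    exact_mod_cast this
  have hsq : Squarefree (d : ℤ) := by exact_mod_cast Int.squarefree_natCast.2 h.squarefree
  obtain ⟨n, rfl⟩ := (hsq.dvd_pow_iff_dvd two_ne_zero).1 (Dvd.intro _ hdw)
  have hn : 2 * y = n := by
    have : (d : ℚ) * (2 * y) = d * n := by rw [← mul_assoc, mul_comm (d : ℚ) 2, hw]; push_cast; ring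
    exact mul_left_cancel₀ hd0 this
  have hmn : m ^ 2 - d * n ^ 2 = 4 * N := by
    have : (m : ℚ) ^ 2 - d * n ^ 2 = 4 * N := by rw [← hm, ← hn, ← hNq]; ring
    exact_mod_cast this
  have hx : (x : K) = m / 2 := by
    rw [eq_div_iff two_ne_zero, mul_comm]; exact_mod_cast congrArg (Rat.cast (K := K)) hm
  have hy : (y : K) = n / 2 := by
    rw [eq_div_iff two_ne_zero, mul_comm]; exact_mod_cast congrArg (Rat.cast (K := K)) hn
  have h4 := h.mod_four
  obtain ⟨e, he⟩ : ∃ e : ℤ, (d : ℤ) = 4 * e + 1 ∨ (d : ℤ) = 4 * e + 2 ∨ (d : ℤ) = 4 * e + 3 :=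
    ⟨d / 4, by omega⟩
  rw [mem_order_iff, hx, hy]
  unfold omega
  split_ifs with h1
  · have he : (d : ℤ) = 4 * e + 1 := by omega
    rw [he] at hmn
    -- For d ≡ 1 mod 4 the relation m² - dn² = 4N forces m and n to have the same parity; in the
    -- other case below it forces both to be even.
    obtain ⟨j, hj⟩ : ∃ j, m = n + 2 * j := by
      rcases Int.even_or_odd' m with ⟨m', rfl | rfl⟩ <;> rcases Int.even_or_odd' n with ⟨n', rfl | rfl⟩
      · exact ⟨m' - n', by ring⟩
      · ring_nf at hmn; omega
      · ring_nf at hmn; omega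
      · exact ⟨m' - n', by ring⟩
    refine ⟨j, n, ?_⟩
    rw [hj]; push_cast; ring
  · have he : (d : ℤ) = 4 * e + 2 ∨ (d : ℤ) = 4 * e + 3 := by omega
    obtain ⟨m', n', rfl, rfl⟩ : ∃ m' n', m = 2 * m' ∧ n = 2 * n' := by
      rcases Int.even_or_odd' m with ⟨m', rfl | rfl⟩ <;> rcases Int.even_or_odd' n with ⟨n', rfl | rfl⟩
      · exact ⟨m', n', rfl, rfl⟩
      all_goals rcases he with he | he <;> rw [he] at hmn <;> ring_nf at hmn <;> omega
    exact ⟨m', n', by push_cast; ring⟩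

/-! ### Content and visible points -/

/-- The largest natural number dividing an element of the order. -/
def content (h : IsRealQuadratic d δ conj) (z : K) : ℕ :=
  open Classical in
  if hz : z ∈ h.order then Int.gcd hz.choose hz.choose_spec.choose else 0

theorem content_eq (h : IsRealQuadratic d δ conj) (a b : ℤ) :
    h.content ((a : K) + (b : K) * omega d δ) = Int.gcd a b := by
  have hz : (a : K) + (b : K) * omega d δ ∈ h.order := ⟨a, b, rfl⟩
  rw [content, dif_pos hz]
  obtain ⟨h1, h2⟩ := h.int_omega_inj hz.choose_spec.choose_spec
  exact congrArg₂ Int.gcd h1.symm h2.symm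

theorem dvd_content (h : IsRealQuadratic d δ conj) {z : K} (hz : z ∈ h.order) (k : ℕ) :
    k ∣ h.content z ↔ ∃ w ∈ h.order, z = k * w := by
  obtain ⟨a, b, rfl⟩ := hz
  rw [h.content_eq]
  constructor
  · intro hk
    obtain ⟨a', rfl⟩ := (Int.natCast_dvd_natCast.2 hk).trans (Int.gcd_dvd_left a b)
    obtain ⟨b', rfl⟩ := (Int.natCast_dvd_natCast.2 hk).trans (Int.gcd_dvd_right (k * a') b)
    exact ⟨_, ⟨a', b', rfl⟩, by push_cast; ring⟩
  · rintro ⟨_, ⟨a', b', rfl⟩, hw⟩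
    obtain ⟨rfl, rfl⟩ := h.int_omega_inj (a := a) (b := b) (a' := k * a') (b' := k * b') (by
      rw [hw]; push_cast; ring)
    exact Int.dvd_gcd (Dvd.intro _ rfl) (Dvd.intro _ rfl)

theorem mem_visible_iff (h : IsRealQuadratic d δ conj) {z : K} :
    z ∈ visible d δ ↔ z ∈ h.order ∧ h.content z = 1 := by
  constructor
  · rintro ⟨a, b, hab, rfl⟩
    exact ⟨⟨a, b, rfl⟩, by rw [h.content_eq, hab]⟩
  · rintro ⟨⟨a, b, rfl⟩, hc⟩
    rw [h.content_eq] at hc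
    exact ⟨a, b, hc, rfl⟩

theorem visible_ne_zero (h : IsRealQuadratic d δ conj) {z : K} (hz : z ∈ visible d δ) : z ≠ 0 := by
  rintro rfl
  have := (h.mem_visible_iff.1 hz).2
  have h1 := h.content_eq 0 0
  simp [this] at h1

theorem content_pos (h : IsRealQuadratic d δ conj) {z : K} (hz : z ∈ h.order) (h0 : z ≠ 0) :
    0 < h.content z := by
  refine Nat.pos_of_ne_zero fun hc => h0 ?_
  obtain ⟨w, -, hw⟩ := (h.dvd_content hz 0).1 (by rw [hc])
  simpa using hw

theorem content_natCast_mul (h : IsRealQuadratic d δ conj) {z : K} (hz : z ∈ h.order) (k : ℕ) :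
    h.content (k * z) = k * h.content z := by
  obtain ⟨a, b, rfl⟩ := hz
  have : (k : K) * ((a : K) + b * omega d δ) = ((k * a : ℤ) : K) + ((k * b : ℤ) : K) * omega d δ := by
    push_cast; ring
  rw [this, h.content_eq, h.content_eq, Int.gcd_mul_left, Int.natAbs_natCast]

theorem content_neg (h : IsRealQuadratic d δ conj) {z : K} (hz : z ∈ h.order) :
    h.content (-z) = h.content z := by
  obtain ⟨a, b, rfl⟩ := hz
  have : -((a : K) + b * omega d δ) = ((-a : ℤ) : K) + ((-b : ℤ) : K) * omega d δ := by
    push_cast; ring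
  rw [this, h.content_eq, h.content_eq, Int.neg_gcd, Int.gcd_neg]

theorem exists_visible (h : IsRealQuadratic d δ conj) {z : K} (hz : z ∈ h.order) (h0 : z ≠ 0) :
    ∃ α ∈ visible d δ, z = h.content z * α := by
  obtain ⟨w, hw, hzw⟩ := (h.dvd_content hz _).1 dvd_rfl
  refine ⟨w, h.mem_visible_iff.2 ⟨hw, ?_⟩, hzw⟩
  have h1 := h.content_natCast_mul hw (h.content z)
  rw [← hzw] at h1
  exact Nat.eq_of_mul_eq_mul_left (h.content_pos hz h0) (by rw [← h1, mul_one])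

/-- Multiplication by a unit is an additive automorphism of the order, so it preserves divisibility
by integers. -/
theorem content_unit_mul (h : IsRealQuadratic d δ conj) {u v z : K} (hu : u ∈ h.order)
    (hv : v ∈ h.order) (huv : u * v = 1) (hz : z ∈ h.order) : h.content (u * z) = h.content z := by
  have huz := h.order.mul_mem hu hz
  refine Nat.dvd_antisymm ?_ ?_
  · obtain ⟨w, hw, e⟩ := (h.dvd_content huz _).1 dvd_rfl
    refine (h.dvd_content hz _).2 ⟨v * w, h.order.mul_mem hv hw, ?_⟩
    calc z = (u * v) * z := by rw [huv, one_mul]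
      _ = v * (u * z) := by ring
      _ = v * (h.content (u * z) * w) := by rw [← e]
      _ = _ := by ring
  · obtain ⟨w, hw, e⟩ := (h.dvd_content hz _).1 dvd_rfl
    refine (h.dvd_content huz _).2 ⟨u * w, h.order.mul_mem hu hw, ?_⟩
    conv_lhs => rw [e]
    ring

theorem unit_mem (h : IsRealQuadratic d δ conj) (u : (𝓞 K)ˣ) : ((u : 𝓞 K) : K) ∈ h.order :=
  h.mem_order_of_isIntegral (u : 𝓞 K).isIntegral_coe

theorem unit_mul_inv {F : Type*} [Field F] (u : (𝓞 F)ˣ) :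
    ((u : 𝓞 F) : F) * ((u⁻¹ : (𝓞 F)ˣ) : 𝓞 F) = 1 := by
  simp

theorem unit_mul_mem_visible (h : IsRealQuadratic d δ conj) (u : (𝓞 K)ˣ) {z : K}
    (hz : z ∈ visible d δ) : ((u : 𝓞 K) : K) * z ∈ visible d δ := by
  rw [h.mem_visible_iff] at hz ⊢
  refine ⟨h.order.mul_mem (h.unit_mem u) hz.1, ?_⟩
  rw [h.content_unit_mul (h.unit_mem u) (h.unit_mem u⁻¹) (unit_mul_inv u) hz.1, hz.2]

theorem neg_mem_visible (h : IsRealQuadratic d δ conj) {z : K} (hz : z ∈ visible d δ) :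
    -z ∈ visible d δ := by
  rw [h.mem_visible_iff] at hz ⊢
  exact ⟨h.order.neg_mem hz.1, by rw [h.content_neg hz.1, hz.2]⟩

/-- Visible points on a common rational line are equal up to sign. -/
theorem visible_eq_or_neg (h : IsRealQuadratic d δ conj) {α β : K} (hα : α ∈ visible d δ)
    (hβ : β ∈ visible d δ) {q : ℚ} (hq : α = q * β) : α = β ∨ α = -β := by
  have hα' := h.mem_visible_iff.1 hα
  have hβ' := h.mem_visible_iff.1 hβ
  -- Comparing contents shows that the numerator and denominator of q agree in absolute value; γ
  -- will be β or -β according to the sign of q.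
  have key : ∀ γ : K, γ ∈ h.order → h.content γ = 1 → (q.den : K) * α = (q.num.natAbs : K) * γ →
      α = γ := by
    intro γ hγ hγ1 e
    have e1 := congrArg h.content e
    rw [h.content_natCast_mul hα'.1, h.content_natCast_mul hγ, hα'.2, hγ1, mul_one, mul_one] at e1
    rw [← e1] at e
    exact mul_left_cancel₀ (by exact_mod_cast q.den_nz) e
  have hden : (q.den : K) * q = q.num := by
    have : (q.den : ℚ) * q = q.num := Rat.den_mul_eq_num q
    exact_mod_cast congrArg (Rat.cast (K := K)) this
  rcases le_total 0 q.num with h0 | h0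
  · left
    refine key β hβ'.1 hβ'.2 ?_
    have : (q.num : K) = (q.num.natAbs : K) := by
      rw [← Int.cast_natCast, Int.natAbs_of_nonneg h0]
    rw [← this, hq, ← mul_assoc, hden]
  · right
    refine key (-β) (h.order.neg_mem hβ'.1) (by rw [h.content_neg hβ'.1, hβ'.2]) ?_
    have : (q.num : K) = -(q.num.natAbs : K) := by
      rw [← Int.cast_natCast, Int.ofNat_natAbs_of_nonpos h0]; push_cast; ring
    rw [mul_neg, ← neg_mul, ← this, hq, ← mul_assoc, hden]

theorem exists_rat_mul_visible (h : IsRealQuadratic d δ conj) {z : K} (hz : z ≠ 0) :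
    ∃ q : ℚ, q ≠ 0 ∧ ∃ α ∈ visible d δ, z = q * α := by
  obtain ⟨x, y, hxy⟩ := h.exists_rat_omega z
  have hx : (x.den : K) * x = x.num := by
    exact_mod_cast congrArg (Rat.cast (K := K)) (Rat.den_mul_eq_num x)
  have hy : (y.den : K) * y = y.num := by
    exact_mod_cast congrArg (Rat.cast (K := K)) (Rat.den_mul_eq_num y)
  have hx0 : (x.den : K) ≠ 0 := by exact_mod_cast x.den_nz
  have hy0 : (y.den : K) ≠ 0 := by exact_mod_cast y.den_nz
  set w : K := x.den * y.den * z with hw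
  have hw0 : w ≠ 0 := mul_ne_zero (mul_ne_zero hx0 hy0) hz
  have hwm : w ∈ h.order := ⟨y.den * x.num, x.den * y.num, by
    rw [hw, hxy]; push_cast; linear_combination (y.den : K) * hx + (x.den : K) * omega d δ * hy⟩
  obtain ⟨α, hα, e⟩ := h.exists_visible hwm hw0
  have hc := h.content_pos hwm hw0
  refine ⟨h.content w / (x.den * y.den), ?_, α, hα, ?_⟩
  · have := x.den_pos; have := y.den_pos
    positivity
  · push_cast
    rw [div_mul_eq_mul_div, eq_div_iff (mul_ne_zero hx0 hy0), ← e, hw]; ring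

/-- The visible point on the line spanned by `δ α`. -/
def dual (h : IsRealQuadratic d δ conj) (α : K) : K := δ * α / h.content (δ * α)

theorem content_delta_mul_pos (h : IsRealQuadratic d δ conj) {α : K} (hα : α ∈ visible d δ) :
    0 < h.content (δ * α) :=
  h.content_pos (h.order.mul_mem h.delta_mem (h.visible_subset_order hα))
    (mul_ne_zero h.delta_ne_zero (h.visible_ne_zero hα))

theorem content_mul_dual (h : IsRealQuadratic d δ conj) {α : K} (hα : α ∈ visible d δ) :
    h.content (δ * α) * h.dual α = δ * α := by
  have : (h.content (δ * α) : K) ≠ 0 := by exact_mod_cast (h.content_delta_mul_pos hα).ne'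
  rw [dual]; field_simp

theorem dual_mem_visible (h : IsRealQuadratic d δ conj) {α : K} (hα : α ∈ visible d δ) :
    h.dual α ∈ visible d δ := by
  have hm := h.order.mul_mem h.delta_mem (h.visible_subset_order hα)
  obtain ⟨β, hβ, e⟩ := h.exists_visible hm (mul_ne_zero h.delta_ne_zero (h.visible_ne_zero hα))
  have : (h.content (δ * α) : K) ≠ 0 := by exact_mod_cast (h.content_delta_mul_pos hα).ne'
  have : h.dual α = β := by rw [dual, div_eq_iff this, mul_comm β, ← e]
  rwa [this]

/-- With c the content of δα, one has dα = δ · δα = c · δ · `h.dual α`, and dα has content d. So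
only finitely many values of c occur. -/
theorem content_delta_mul_dvd (h : IsRealQuadratic d δ conj) {α : K} (hα : α ∈ visible d δ) :
    h.content (δ * α) ∣ d := by
  have hα' := h.mem_visible_iff.1 hα
  have h1 : h.content ((d : K) * α) = d := by rw [h.content_natCast_mul hα'.1, hα'.2, mul_one]
  conv_rhs => rw [← h1]
  refine (h.dvd_content (h.order.mul_mem (natCast_mem _ _) hα'.1) _).2
    ⟨δ * h.dual α, h.order.mul_mem h.delta_mem (h.visible_subset_order (h.dual_mem_visible hα)), ?_⟩
  rw [← h.sq_eq]
  linear_combination -δ * h.content_mul_dual hα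

end IsRealQuadratic
-- The homomorphism log |z / z̄| and the absolute norm
/-- `log |z / z̄|`. -/
def logRatio {K : Type*} [Field K] [NumberField K] (ι : K →+* ℝ) (conj : K ≃ₐ[ℚ] K) (z : K) : ℝ :=
  Real.log |ι z / ι (conj z)|

/-- `|N(z)|` as a real number. -/
def realNorm {K : Type*} [Field K] [NumberField K] (ι : K →+* ℝ) (conj : K ≃ₐ[ℚ] K) (z : K) : ℝ :=
  |ι z * ι (conj z)|

section

variable {K : Type*} [Field K] [NumberField K] (ι : K →+* ℝ) (conj : K ≃ₐ[ℚ] K)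

theorem embedding_ne_zero {F : Type*} [Field F] (ι : F →+* ℝ) {z : F} (hz : z ≠ 0) : ι z ≠ 0 :=
  (map_ne_zero ι).2 hz

theorem embedding_conj_ne_zero {z : K} (hz : z ≠ 0) : ι (conj z) ≠ 0 :=
  (map_ne_zero ι).2 ((map_ne_zero conj).2 hz)

theorem phi_piMap (ε : (𝓞 K)ˣ) (z : K) :
    phi ι ε (piMap conj z) = ((logRatio ι conj z : ℝ) : AddCircle (period ι ε)) := by
  rw [phi, piMap, map_div₀, logRatio]

theorem logRatio_mul {z w : K} (hz : z ≠ 0) (hw : w ≠ 0) :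
    logRatio ι conj (z * w) = logRatio ι conj z + logRatio ι conj w := by
  have h1 := embedding_ne_zero ι hz
  have h2 := embedding_ne_zero ι hw
  have h3 := embedding_conj_ne_zero ι conj hz
  have h4 := embedding_conj_ne_zero ι conj hw
  rw [logRatio, logRatio, logRatio, ← Real.log_mul (by positivity) (by positivity), ← abs_mul,
    map_mul, map_mul, map_mul]
  congr 2
  field_simp

theorem logRatio_rat {q : ℚ} (hq : q ≠ 0) : logRatio ι conj (q : K) = 0 := by
  have : (q : ℝ) ≠ 0 := by exact_mod_cast hq
  simp [logRatio, this]

theorem logRatio_neg (z : K) : logRatio ι conj (-z) = logRatio ι conj z := by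
  simp [logRatio]

theorem logRatio_one : logRatio ι conj (1 : K) = 0 := by simp [logRatio]

theorem realNorm_mul (z w : K) :
    realNorm ι conj (z * w) = realNorm ι conj z * realNorm ι conj w := by
  rw [realNorm, realNorm, realNorm, ← abs_mul, map_mul, map_mul, map_mul]
  congr 1; ring

theorem realNorm_natCast (k : ℕ) : realNorm ι conj (k : K) = k ^ 2 := by
  simp [realNorm, sq]

theorem realNorm_pos {z : K} (hz : z ≠ 0) : 0 < realNorm ι conj z :=
  abs_pos.2 (mul_ne_zero (embedding_ne_zero ι hz) (embedding_conj_ne_zero ι conj hz))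

end

namespace IsRealQuadratic

variable {K : Type*} [Field K] [NumberField K] {d : ℕ} {δ : K} {conj : K ≃ₐ[ℚ] K}

theorem realNorm_eq (h : IsRealQuadratic d δ conj) (ι : K →+* ℝ) (z : K) :
    realNorm ι conj z = |((Algebra.norm ℚ z : ℚ) : ℝ)| := by
  rw [realNorm, h.norm_real ι]

theorem one_le_realNorm (h : IsRealQuadratic d δ conj) (ι : K →+* ℝ) {z : K} (hz : z ∈ h.order)
    (h0 : z ≠ 0) : 1 ≤ realNorm ι conj z := by
  obtain ⟨m, hm⟩ := h.exists_int_norm hz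
  have h1 := realNorm_pos ι conj h0
  rw [h.realNorm_eq, hm, Rat.cast_intCast] at h1 ⊢
  have : m ≠ 0 := by rintro rfl; simp at h1
  exact_mod_cast Int.one_le_abs this

theorem realNorm_unit (h : IsRealQuadratic d δ conj) (ι : K →+* ℝ) (u : (𝓞 K)ˣ) :
    realNorm ι conj ((u : 𝓞 K) : K) = 1 := by
  have hu : ((u : 𝓞 K) : K) ≠ 0 := by simp
  have hv : ((u⁻¹ : (𝓞 K)ˣ) : 𝓞 K) ≠ (0 : K) := by simp
  have h1 := h.one_le_realNorm ι (h.unit_mem u) hu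
  have h2 := h.one_le_realNorm ι (h.unit_mem u⁻¹) hv
  have h3 : realNorm ι conj ((u : 𝓞 K) : K) * realNorm ι conj ((u⁻¹ : (𝓞 K)ˣ) : 𝓞 K) = 1 := by
    rw [← realNorm_mul, unit_mul_inv]
    simp [realNorm]
  nlinarith

theorem realNorm_delta (h : IsRealQuadratic d δ conj) (ι : K →+* ℝ) : realNorm ι conj δ = d := by
  have := congrArg ι h.sq_eq
  rw [map_pow, map_natCast] at this
  rw [realNorm, h.conj_eq, map_neg, mul_neg, abs_neg, ← sq, this, Nat.abs_cast]

theorem logRatio_delta (h : IsRealQuadratic d δ conj) (ι : K →+* ℝ) : logRatio ι conj δ = 0 := by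
  have := embedding_ne_zero ι h.delta_ne_zero
  rw [logRatio, h.conj_eq, map_neg, div_neg, div_self this]
  simp

/-- Since |ε ε̄| = 1, |ε / ε̄| = |ε²|. -/
theorem logRatio_fundamentalUnit (h : IsRealQuadratic d δ conj) (ι : K →+* ℝ) (ε : (𝓞 K)ˣ) :
    logRatio ι conj ((ε : 𝓞 K) : K) = period ι ε := by
  have h1 := h.realNorm_unit ι ε
  have hu : ((ε : 𝓞 K) : K) ≠ 0 := by simp
  have h3 := abs_pos.2 (embedding_conj_ne_zero ι conj hu)
  rw [realNorm, abs_mul] at h1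
  rw [logRatio, period, abs_div, map_pow, abs_pow, sq]
  congr 1
  rw [div_eq_iff h3.ne']
  linear_combination -|ι ((ε : 𝓞 K) : K)| * h1

theorem coe_zpow_ne_zero {F : Type*} [Field F] (ε : (𝓞 F)ˣ) (k : ℤ) :
    (((ε ^ k : (𝓞 F)ˣ) : 𝓞 F) : F) ≠ 0 := by simp

theorem logRatio_zpow (h : IsRealQuadratic d δ conj) (ι : K →+* ℝ) (ε : (𝓞 K)ˣ) (k : ℤ) :
    logRatio ι conj (((ε ^ k : (𝓞 K)ˣ) : 𝓞 K) : K) = k * period ι ε := by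
  let f : (𝓞 K)ˣ →* Multiplicative ℝ :=
    { toFun := fun u => Multiplicative.ofAdd (logRatio ι conj ((u : 𝓞 K) : K))
      map_one' := by simp [logRatio_one]
      map_mul' := fun u v => by
        rw [← ofAdd_add, ← logRatio_mul ι conj (by simp) (by simp)]; simp }
  have h1 : f (ε ^ k) = f ε ^ k := map_zpow f ε k
  have h2 := congrArg Multiplicative.toAdd h1
  rw [toAdd_zpow] at h2
  change logRatio ι conj (((ε ^ k : (𝓞 K)ˣ) : 𝓞 K) : K) = k • logRatio ι conj ((ε : 𝓞 K) : K) at h2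
  rw [h2, h.logRatio_fundamentalUnit, zsmul_eq_mul]

/-- The hypothesis means |z| = |z̄|, hence z = ± z̄. The two signs are the source of the two classes
over each ξ. -/
theorem exists_rat_of_logRatio_eq_zero (h : IsRealQuadratic d δ conj) (ι : K →+* ℝ) {z : K}
    (hz : z ≠ 0) (h0 : logRatio ι conj z = 0) : ∃ q : ℚ, z = q ∨ z = q * δ := by
  have h1 := embedding_ne_zero ι hz
  have h2 := embedding_conj_ne_zero ι conj hz
  have h3 : |ι z / ι (conj z)| = 1 :=
    Real.eq_one_of_pos_of_log_eq_zero (by positivity) h0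
  rw [abs_div, div_eq_one_iff_eq (by positivity), abs_eq_abs] at h3
  refine h.eq_or_eq_of_conj ?_
  rcases h3 with h3 | h3
  · exact Or.inl (ι.injective h3)
  · exact Or.inr (ι.injective (by rw [h3, map_neg]))

/-- If the period were zero, every unit would lie in ℚ ∪ ℚδ. A solution of Pell's equation with y ≠
0 gives the unit x + yδ, and x ≠ 0 since -dy² ≠ 1. -/
theorem period_ne_zero (h : IsRealQuadratic d δ conj) (ι : K →+* ℝ) {ε : (𝓞 K)ˣ}
    (hε : IsFundamentalUnit ε) : period ι ε ≠ 0 := by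
  intro h0
  obtain ⟨x, y, hxy, hy⟩ := Pell.exists_of_not_isSquare (d := (d : ℤ))
    (by have := h.one_lt; omega) (by rw [Int.isSquare_natCast_iff]; exact h.not_isSquare)
  have hx' : IsIntegral ℤ (x : K) := by simpa using isIntegral_algebraMap (R := ℤ) (A := K) (x := x)
  have hy' : IsIntegral ℤ (y : K) := by simpa using isIntegral_algebraMap (R := ℤ) (A := K) (x := y)
  have hK : (x : K) ^ 2 - d * (y : K) ^ 2 = 1 := by exact_mod_cast congrArg (Int.cast (R := K)) hxy
  let u : (𝓞 K)ˣ :=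
    { val := ⟨x + y * δ, hx'.add (hy'.mul h.delta_isIntegral)⟩
      inv := ⟨x - y * δ, hx'.sub (hy'.mul h.delta_isIntegral)⟩
      val_inv := by
        apply NumberField.RingOfIntegers.ext
        change ((x : K) + y * δ) * (x - y * δ) = 1
        linear_combination hK - (y : K) ^ 2 * h.sq_eq
      inv_val := by
        apply NumberField.RingOfIntegers.ext
        change ((x : K) - y * δ) * (x + y * δ) = 1
        linear_combination hK - (y : K) ^ 2 * h.sq_eq }
  have hu : ((u : 𝓞 K) : K) = (x : K) + y * δ := rfl
  have hlog : logRatio ι conj ((u : 𝓞 K) : K) = 0 := by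
    obtain ⟨k, hk | hk⟩ := hε u
    · rw [hk, h.logRatio_zpow, h0, mul_zero]
    · have : ((-ε ^ k : (𝓞 K)ˣ) : 𝓞 K) = -(((ε ^ k : (𝓞 K)ˣ) : 𝓞 K) : K) := by simp
      rw [hk, this, logRatio_neg, h.logRatio_zpow, h0, mul_zero]
  obtain ⟨q, hq | hq⟩ := h.exists_rat_of_logRatio_eq_zero ι (by simp) hlog
  · rw [hu] at hq
    have := h.rat_add_mul_eq_zero (x := x - q) (y := y) (by push_cast; linear_combination hq)
    exact hy (by exact_mod_cast this.2)
  · rw [hu] at hq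
    have := h.rat_add_mul_eq_zero (x := x) (y := y - q) (by push_cast; linear_combination hq)
    have hx : x = 0 := by exact_mod_cast this.1
    rw [hx] at hxy
    have : 0 ≤ (d : ℤ) * y ^ 2 := by positivity
    omega

theorem logRatio_dual (h : IsRealQuadratic d δ conj) (ι : K →+* ℝ) {α : K}
    (hα : α ∈ visible d δ) : logRatio ι conj (h.dual α) = logRatio ι conj α := by
  have h1 := congrArg (logRatio ι conj) (h.content_mul_dual hα)
  have hc := (h.content_delta_mul_pos hα).ne'
  have hc' : (h.content (δ * α) : K) ≠ 0 := by exact_mod_cast hc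
  have hq := logRatio_rat ι conj (q := h.content (δ * α)) (by exact_mod_cast hc)
  rw [Rat.cast_natCast] at hq
  rwa [logRatio_mul ι conj hc' (h.visible_ne_zero (h.dual_mem_visible hα)),
    logRatio_mul ι conj h.delta_ne_zero (h.visible_ne_zero hα), hq, h.logRatio_delta, zero_add,
    zero_add] at h1

theorem realNorm_dual (h : IsRealQuadratic d δ conj) (ι : K →+* ℝ) {α : K}
    (hα : α ∈ visible d δ) :
    (h.content (δ * α) : ℝ) ^ 2 * realNorm ι conj (h.dual α) = d * realNorm ι conj α := by
  have h1 := congrArg (realNorm ι conj) (h.content_mul_dual hα)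
  rwa [realNorm_mul, realNorm_mul, realNorm_natCast, h.realNorm_delta] at h1

theorem pairNorm_eq (h : IsRealQuadratic d δ conj) (ι : K →+* ℝ) (α β : K) :
    pairNorm α β = √(realNorm ι conj α * realNorm ι conj β) := by
  rw [pairNorm, h.realNorm_eq, h.realNorm_eq, ← abs_mul, Rat.cast_mul]

theorem pairNorm_dual (h : IsRealQuadratic d δ conj) (ι : K →+* ℝ) {α : K}
    (hα : α ∈ visible d δ) :
    pairNorm α (h.dual α) = realNorm ι conj α * √d / h.content (δ * α) := by
  have hc : (0 : ℝ) < h.content (δ * α) := by exact_mod_cast h.content_delta_mul_pos hα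
  have h0 := realNorm_pos ι conj (h.visible_ne_zero hα)
  rw [h.pairNorm_eq ι, Real.sqrt_eq_iff_mul_self_eq (by unfold realNorm; positivity) (by positivity)]
  have hd : √(d : ℝ) * √d = d := Real.mul_self_sqrt (by positivity)
  have := h.realNorm_dual ι hα
  field_simp
  rw [sq, sq, hd]
  nlinarith

/-! ### The fibres over the circle and the value of M -/

/-- Visible points whose logarithmic ratios agree modulo the period. -/
theorem eq_unit_mul_of_logRatio (h : IsRealQuadratic d δ conj) (ι : K →+* ℝ) (ε : (𝓞 K)ˣ)
    {α β : K} (hα : α ∈ visible d δ) (hβ : β ∈ visible d δ) (k : ℤ)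
    (hk : logRatio ι conj α = logRatio ι conj β + k * period ι ε) :
    ∃ u : (𝓞 K)ˣ, (u = ε ^ k ∨ u = -ε ^ k) ∧
      (α = ((u : 𝓞 K) : K) * β ∨ α = ((u : 𝓞 K) : K) * h.dual β) := by
  have hα0 := h.visible_ne_zero hα
  have hβ0 := h.visible_ne_zero hβ
  have hε0 := coe_zpow_ne_zero ε k
  set e := (((ε ^ k : (𝓞 K)ˣ) : 𝓞 K) : K) with he
  have hne : ((-ε ^ k : (𝓞 K)ˣ) : 𝓞 K) = -e := by rw [he]; simp
  -- This quotient is in the kernel, so it is rational or a rational multiple of δ; the first case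
  -- leads to β and the second to `h.dual β`.
  have hlog : logRatio ι conj (α / (e * β)) = 0 := by
    have h1 := logRatio_mul ι conj (div_ne_zero hα0 (mul_ne_zero hε0 hβ0)) (mul_ne_zero hε0 hβ0)
    rw [div_mul_cancel₀ _ (mul_ne_zero hε0 hβ0), logRatio_mul ι conj hε0 hβ0, he,
      h.logRatio_zpow] at h1
    linarith
  have conclude : ∀ γ : K, γ ∈ visible d δ → (∃ q : ℚ, α = q * (e * γ)) →
      ∃ u : (𝓞 K)ˣ, (u = ε ^ k ∨ u = -ε ^ k) ∧ α = ((u : 𝓞 K) : K) * γ := by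
    rintro γ hγ ⟨q, hq⟩
    rcases h.visible_eq_or_neg hα (h.unit_mul_mem_visible (ε ^ k) hγ) hq with h1 | h1
    · exact ⟨_, Or.inl rfl, h1⟩
    · exact ⟨_, Or.inr rfl, by rw [hne, neg_mul]; exact h1⟩
  obtain ⟨q, hq⟩ := h.exists_rat_of_logRatio_eq_zero ι
    (div_ne_zero hα0 (mul_ne_zero hε0 hβ0)) hlog
  rw [div_eq_iff (mul_ne_zero hε0 hβ0), div_eq_iff (mul_ne_zero hε0 hβ0)] at hq
  rcases hq with hq | hq
  · obtain ⟨u, hu, h1⟩ := conclude β hβ ⟨q, hq⟩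
    exact ⟨u, hu, Or.inl h1⟩
  · obtain ⟨u, hu, h1⟩ := conclude _ (h.dual_mem_visible hβ) ⟨q * h.content (δ * β), by
      rw [hq]; push_cast; linear_combination -(q : K) * e * h.content_mul_dual hβ⟩
    exact ⟨u, hu, Or.inr h1⟩

theorem rayEquiv_of_unit_mul {F : Type*} [Field F] {α β γ : F} {u v : (𝓞 F)ˣ} (hα : α = ((u : 𝓞 F) : F) * γ)
    (hβ : β = ((v : 𝓞 F) : F) * γ) : RayEquiv α β := by
  refine ⟨u * v⁻¹, 1, 1, one_pos, one_pos, ?_⟩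
  have := unit_mul_inv v
  have e : (((u * v⁻¹ : (𝓞 F)ˣ) : 𝓞 F) : F) = ((u : 𝓞 F) : F) * ((v⁻¹ : (𝓞 F)ˣ) : 𝓞 F) :=
    map_mul (algebraMap (𝓞 F) F) _ _
  rw [hα, hβ, e, Nat.cast_one]
  linear_combination ((u : 𝓞 F) : F) * γ * this

/-- Taking norms in an equivalence and combining with c² |N(α')| = d |N(α)| would give d = (cn /
m)². -/
theorem not_rayEquiv_dual (h : IsRealQuadratic d δ conj) (ι : K →+* ℝ) {α : K}
    (hα : α ∈ visible d δ) : ¬ RayEquiv α (h.dual α) := by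
  rintro ⟨u, m, n, hm, hn, e⟩
  have hα0 := realNorm_pos ι conj (h.visible_ne_zero hα)
  have e1 := congrArg (realNorm ι conj) e
  rw [realNorm_mul, realNorm_mul, realNorm_mul, h.realNorm_unit, realNorm_natCast,
    realNorm_natCast, one_mul] at e1
  have e2 := h.realNorm_dual ι hα
  have hm' : (m : ℝ) ≠ 0 := by positivity
  refine h.rat_sq_ne (h.content (δ * α) * n / m) ?_
  have : (h.content (δ * α) * n / m : ℝ) ^ 2 = d := by
    rw [div_pow, div_eq_iff (by positivity)]
    refine mul_right_cancel₀ hα0.ne' ?_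
    linear_combination (m : ℝ) ^ 2 * e2 - (h.content (δ * α) : ℝ) ^ 2 * e1
  apply Rat.cast_injective (α := ℝ)
  push_cast
  exact this

theorem piMap_mem_normOne (h : IsRealQuadratic d δ conj) {z : K} (hz : z ≠ 0) :
    piMap conj z ∈ normOne K := by
  change Algebra.norm ℚ (piMap conj z) = 1
  have h1 := h.norm_eq (piMap conj z)
  have hc : conj z ≠ 0 := (map_ne_zero conj).2 hz
  have e : piMap conj z * conj (piMap conj z) = 1 := by
    rw [piMap, map_div₀, h.conj_conj]; field_simp
  rw [e] at h1
  exact_mod_cast h1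

theorem exists_visible_of_mem (h : IsRealQuadratic d δ conj) (ι : K →+* ℝ) (ε : (𝓞 K)ˣ)
    {ξ : AddCircle (period ι ε)} (hξ : ξ ∈ phi ι ε '' normOne K) :
    ∃ α ∈ visible d δ, ((logRatio ι conj α : ℝ) : AddCircle (period ι ε)) = ξ := by
  obtain ⟨β, hβ, rfl⟩ := hξ
  have hN : β * conj β = 1 := by
    rw [← h.norm_eq, show Algebra.norm ℚ β = 1 from hβ]; simp
  -- Hilbert 90: z = 1 + β works since β(1 + β̄) = β + 1, except for β = -1, where z = δ.
  obtain ⟨z, hz, e⟩ : ∃ z : K, z ≠ 0 ∧ piMap conj z = β := by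
    by_cases h1 : β = -1
    · refine ⟨δ, h.delta_ne_zero, ?_⟩
      rw [piMap, h.conj_eq, div_neg, div_self h.delta_ne_zero, h1]
    · have h2 : 1 + β ≠ 0 := fun h3 => h1 (by linear_combination h3)
      refine ⟨1 + β, h2, ?_⟩
      rw [piMap, div_eq_iff ((map_ne_zero conj).2 h2), map_add, map_one]
      linear_combination -hN
  obtain ⟨q, hq, α, hα, rfl⟩ := h.exists_rat_mul_visible hz
  refine ⟨α, hα, ?_⟩
  rw [← e, phi_piMap, logRatio_mul ι conj (by exact_mod_cast hq) (h.visible_ne_zero hα),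
    logRatio_rat ι conj hq, zero_add]

theorem isPreimagePair_dual (h : IsRealQuadratic d δ conj) (ι : K →+* ℝ) (ε : (𝓞 K)ˣ) {α : K}
    (hα : α ∈ visible d δ) :
    IsPreimagePair d δ conj ι ε (logRatio ι conj α : ℝ) α (h.dual α) := by
  refine ⟨hα, h.dual_mem_visible hα, h.not_rayEquiv_dual ι hα, phi_piMap _ _ _ _, ?_⟩
  rw [phi_piMap, h.logRatio_dual ι hα]

theorem exists_logRatio_eq_of_coe_eq {ι : K →+* ℝ} {ε : (𝓞 K)ˣ} {α β : K}
    (hαβ : ((logRatio ι conj α : ℝ) : AddCircle (period ι ε)) = (logRatio ι conj β : ℝ)) :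
    ∃ k : ℤ, logRatio ι conj α = logRatio ι conj β + k * period ι ε := by
  rw [QuotientAddGroup.eq_iff_sub_mem, AddSubgroup.mem_zmultiples_iff] at hαβ
  obtain ⟨k, hk⟩ := hαβ
  rw [zsmul_eq_mul] at hk
  exact ⟨k, by linarith⟩

/-- Each of α, β is a unit times γ or `h.dual γ`. Non-equivalence forces one of each kind, and units
do not change the absolute norm. -/
theorem pairNorm_eq_of_isPreimagePair (h : IsRealQuadratic d δ conj) (ι : K →+* ℝ) (ε : (𝓞 K)ˣ)
    {γ α β : K} (hγ : γ ∈ visible d δ)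
    (hαβ : IsPreimagePair d δ conj ι ε (logRatio ι conj γ : ℝ) α β) :
    pairNorm α β = pairNorm γ (h.dual γ) := by
  obtain ⟨hα, hβ, hne, h1, h2⟩ := hαβ
  rw [phi_piMap] at h1 h2
  obtain ⟨k, hk⟩ := exists_logRatio_eq_of_coe_eq h1
  obtain ⟨l, hl⟩ := exists_logRatio_eq_of_coe_eq h2
  obtain ⟨u, -, hu⟩ := h.eq_unit_mul_of_logRatio ι ε hα hγ k hk
  obtain ⟨v, -, hv⟩ := h.eq_unit_mul_of_logRatio ι ε hβ hγ l hl
  rw [h.pairNorm_eq ι, h.pairNorm_eq ι]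
  rcases hu with hu | hu <;> rcases hv with hv | hv
  · exact absurd (rayEquiv_of_unit_mul hu hv) hne
  · rw [hu, hv, realNorm_mul, realNorm_mul, h.realNorm_unit, h.realNorm_unit, one_mul, one_mul]
  · rw [hu, hv, realNorm_mul, realNorm_mul, h.realNorm_unit, h.realNorm_unit, one_mul, one_mul,
      mul_comm]
  · exact absurd (rayEquiv_of_unit_mul hu hv) hne

theorem M_eq_pairNorm (h : IsRealQuadratic d δ conj) (ι : K →+* ℝ) (ε : (𝓞 K)ˣ) {γ : K}
    (hγ : γ ∈ visible d δ) :
    M d δ conj ι ε (logRatio ι conj γ : ℝ) = pairNorm γ (h.dual γ) := by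
  obtain ⟨α, β, hp, hr⟩ := Classical.epsilon_spec (p := fun r : ℝ => ∃ α α' : K,
    IsPreimagePair d δ conj ι ε (logRatio ι conj γ : ℝ) α α' ∧ r = pairNorm α α')
    ⟨_, γ, h.dual γ, h.isPreimagePair_dual ι ε hγ, rfl⟩
  rw [← h.pairNorm_eq_of_isPreimagePair ι ε hγ hp, ← hr]
  rfl

theorem M_well_defined (h : IsRealQuadratic d δ conj) (ι : K →+* ℝ) (ε : (𝓞 K)ˣ)
    {ξ : AddCircle (period ι ε)} (hξ : ξ ∈ phi ι ε '' normOne K) :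
    (∃ α α' : K, IsPreimagePair d δ conj ι ε ξ α α') ∧
      ∀ α α' : K, IsPreimagePair d δ conj ι ε ξ α α' → M d δ conj ι ε ξ = pairNorm α α' := by
  obtain ⟨γ, hγ, rfl⟩ := h.exists_visible_of_mem ι ε hξ
  refine ⟨⟨γ, h.dual γ, h.isPreimagePair_dual ι ε hγ⟩, fun α α' hp => ?_⟩
  rw [h.M_eq_pairNorm ι ε hγ, h.pairNorm_eq_of_isPreimagePair ι ε hγ hp]

/-- The visible points over a point of the circle, in a fundamental domain for `ε`. -/
theorem ncard_fiber (h : IsRealQuadratic d δ conj) (ι : K →+* ℝ) {ε : (𝓞 K)ˣ}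
    (hε : IsFundamentalUnit ε) {ξ : AddCircle (period ι ε)} (hξ : ξ ∈ phi ι ε '' normOne K) :
    {α : K | α ∈ visible d δ ∧ logRatio ι conj α ∈ Set.Ico 0 |period ι ε| ∧
      ((logRatio ι conj α : ℝ) : AddCircle (period ι ε)) = ξ}.ncard = 4 := by
  have hp := abs_pos.2 (h.period_ne_zero ι hε)
  obtain ⟨β, hβ, rfl⟩ := h.exists_visible_of_mem ι ε hξ
  obtain ⟨α, hα, hmem, hαβ⟩ : ∃ α ∈ visible d δ, logRatio ι conj α ∈ Set.Ico 0 |period ι ε| ∧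
      ((logRatio ι conj α : ℝ) : AddCircle (period ι ε)) = (logRatio ι conj β : ℝ) := by
    obtain ⟨k, hk, -⟩ := existsUnique_add_zsmul_mem_Ico hp (logRatio ι conj β) 0
    -- The period may be negative, so a translation by k|`period`| is realised by ε^k or ε^(-k).
    obtain ⟨l, hl⟩ : ∃ l : ℤ, k • |period ι ε| = l * period ι ε := by
      rcases abs_choice (period ι ε) with h1 | h1
      · exact ⟨k, by rw [h1, zsmul_eq_mul]⟩
      · exact ⟨-k, by rw [h1, zsmul_eq_mul]; push_cast; ring⟩
    have e : logRatio ι conj ((((ε ^ l : (𝓞 K)ˣ) : 𝓞 K) : K) * β)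
        = logRatio ι conj β + l * period ι ε := by
      rw [logRatio_mul ι conj (coe_zpow_ne_zero ε l) (h.visible_ne_zero hβ), h.logRatio_zpow,
        add_comm]
    refine ⟨_, h.unit_mul_mem_visible (ε ^ l) hβ, ?_, ?_⟩
    · rw [e, ← hl]; simpa using hk
    · rw [e, QuotientAddGroup.eq_iff_sub_mem, AddSubgroup.mem_zmultiples_iff]
      exact ⟨l, by rw [zsmul_eq_mul]; ring⟩
  have hdual := h.dual_mem_visible hα
  have hset : {γ : K | γ ∈ visible d δ ∧ logRatio ι conj γ ∈ Set.Ico 0 |period ι ε| ∧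
      ((logRatio ι conj γ : ℝ) : AddCircle (period ι ε)) = (logRatio ι conj β : ℝ)}
      = {α, -α, h.dual α, -h.dual α} := by
    ext γ
    simp only [Set.mem_ofPred_eq, Set.mem_insert_iff, Set.mem_singleton_iff]
    constructor
    · rintro ⟨hγ, hγm, hγβ⟩
      obtain ⟨k, hk⟩ := exists_logRatio_eq_of_coe_eq (hγβ.trans hαβ.symm)
      -- Both values lie in a half-open interval of length |`period`|.
      have hk0 : k = 0 := by
        have h1 : |(k : ℝ) * period ι ε| < |period ι ε| := by
          rw [show (k : ℝ) * period ι ε = logRatio ι conj γ - logRatio ι conj α by linarith, abs_lt]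
          constructor <;> linarith [hγm.1, hγm.2, hmem.1, hmem.2]
        rw [abs_mul] at h1
        have h2 : |(k : ℝ)| < 1 := by
          by_contra h3
          nlinarith
        exact Int.abs_lt_one_iff.1 (by exact_mod_cast h2)
      obtain ⟨u, hu, h1⟩ := h.eq_unit_mul_of_logRatio ι ε hγ hα k hk
      subst hk0
      rw [zpow_zero] at hu
      rcases hu with rfl | rfl <;> rcases h1 with h1 | h1 <;> simp [h1]
    · have hd := h.logRatio_dual ι hα
      rintro (rfl | rfl | rfl | rfl)
      · exact ⟨hα, hmem, hαβ⟩
      · rw [logRatio_neg]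
        exact ⟨h.neg_mem_visible hα, hmem, hαβ⟩
      · rw [hd]
        exact ⟨hdual, hmem, hαβ⟩
      · rw [logRatio_neg, hd]
        exact ⟨h.neg_mem_visible hdual, hmem, hαβ⟩
  have hα0 := h.visible_ne_zero hα
  -- The cases s = 1 and s = -1 separate the dual point from ±α.
  have hne : ∀ s : (𝓞 K)ˣ, h.dual α ≠ ((s : 𝓞 K) : K) * α := fun s hs =>
    h.not_rayEquiv_dual ι hα (rayEquiv_of_unit_mul (γ := α) (u := 1) (v := s) (by simp) hs)
  have h1 : h.dual α ≠ α := by simpa using hne 1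
  have h2 : h.dual α ≠ -α := by simpa using hne (-1)
  have h3 : α ≠ -α := fun e => hα0 (self_eq_neg.1 e)
  have h4 : h.dual α ≠ -h.dual α := fun e => h.visible_ne_zero hdual (self_eq_neg.1 e)
  classical
  have hfin : ({α, -α, h.dual α, -h.dual α} : Set K)
      = (({α, -α, h.dual α, -h.dual α} : Finset K) : Set K) := by simp
  rw [hset, hfin, Set.ncard_coe_finset, card_insert_of_notMem, card_insert_of_notMem,
    card_insert_of_notMem, card_singleton]
  · simpa using h4
  · simp only [mem_insert, mem_singleton, not_or]
    exact ⟨h2.symm, fun e => h1 (neg_injective e.symm)⟩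
  · simp only [mem_insert, mem_singleton, not_or]
    exact ⟨h3, h1.symm, fun e => h2 (neg_eq_iff_eq_neg.2 e).symm⟩

end IsRealQuadratic
-- Densities of lattices in the order
/-- The nonzero elements of `X` with `log |z / z̄|` in `[a, b)` and `|N(z)| ≤ T`. -/
def arcSet {K : Type*} [Field K] [NumberField K] (ι : K →+* ℝ) (conj : K ≃ₐ[ℚ] K) (X : Set K)
    (a b T : ℝ) : Set K :=
  {z ∈ X | z ≠ 0 ∧ logRatio ι conj z ∈ Set.Ico a b ∧ realNorm ι conj z ≤ T}

/-- The elements of `X` are equidistributed with respect to `log |z / z̄|`, with density `κ`. -/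
def HasDensity {K : Type*} [Field K] [NumberField K] (ι : K →+* ℝ) (conj : K ≃ₐ[ℚ] K) (X : Set K)
    (κ : ℝ) : Prop :=
  ∀ a b : ℝ, a ≤ b → Tendsto (fun T : ℝ => ((arcSet ι conj X a b T).ncard : ℝ) / T) atTop
    (𝓝 (κ * (b - a)))

/-- The two real embeddings of `K`. -/
def embed {K : Type*} [Field K] [NumberField K] (ι : K →+* ℝ) (conj : K ≃ₐ[ℚ] K) :
    K →+ (Fin 2 → ℝ) where
  toFun z := ![ι z, ι (conj z)]
  map_zero' := by ext i; fin_cases i <;> simp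
  map_add' x y := by ext i; fin_cases i <;> simp

section

variable {K : Type*} [Field K] [NumberField K] (ι : K →+* ℝ) (conj : K ≃ₐ[ℚ] K)

theorem embed_zero (z : K) : embed ι conj z 0 = ι z := rfl

theorem embed_one (z : K) : embed ι conj z 1 = ι (conj z) := rfl

theorem embed_injective : Function.Injective (embed ι conj) := fun _ _ hxy =>
  ι.injective (congrFun hxy 0)

theorem arcSet_eq (X : Set K) (a b T : ℝ) :
    arcSet ι conj X a b T = {z ∈ X | embed ι conj z ∈ hyperbolicSector a b T} := by
  ext z
  refine and_congr_right fun _ => ?_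
  constructor
  · rintro ⟨h0, h1, h2⟩
    exact ⟨(mem_sector_iff (embedding_ne_zero ι h0) (embedding_conj_ne_zero ι conj h0)).2 h1, h2⟩
  · rintro ⟨h1, h2⟩
    have h3 := sector_ne_zero h1
    exact ⟨(map_ne_zero ι).1 h3.1, (mem_sector_iff h3.1 h3.2).1 h1, h2⟩

theorem arcSet_mono {X Y : Set K} (hXY : X ⊆ Y) {a b a' b' T T' : ℝ} (ha : a' ≤ a) (hb : b ≤ b')
    (hT : T ≤ T') : arcSet ι conj X a b T ⊆ arcSet ι conj Y a' b' T' :=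
  fun _ hz => ⟨hXY hz.1, hz.2.1, ⟨ha.trans hz.2.2.1.1, hz.2.2.1.2.trans_le hb⟩, hz.2.2.2.trans hT⟩

variable {ι conj}

theorem HasDensity.nonneg {X : Set K} {κ : ℝ} (h : HasDensity ι conj X κ) : 0 ≤ κ := by
  have h1 := h 0 1 zero_le_one
  rw [sub_zero, mul_one] at h1
  refine ge_of_tendsto h1 ?_
  filter_upwards [eventually_ge_atTop 0] with T hT
  positivity

theorem HasDensity.unique {X : Set K} {κ κ' : ℝ} (h : HasDensity ι conj X κ)
    (h' : HasDensity ι conj X κ') : κ = κ' := by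
  have := tendsto_nhds_unique (h 0 1 zero_le_one) (h' 0 1 zero_le_one)
  simpa using this

end

namespace IsRealQuadratic

variable {K : Type*} [Field K] [NumberField K] {d : ℕ} {δ : K} {conj : K ≃ₐ[ℚ] K}

theorem linearIndependent_embed (h : IsRealQuadratic d δ conj) (ι : K →+* ℝ) :
    LinearIndependent ℝ ![embed ι conj 1, embed ι conj (omega d δ)] := by
  obtain ⟨t, n, k, r, -, h2, -⟩ := h.omega_spec
  rw [LinearIndependent.pair_iff]
  intro x y hxy
  have e0 := congrFun hxy 0
  have e1 := congrFun hxy 1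
  simp only [Pi.add_apply, Pi.smul_apply, embed_zero, embed_one, map_one, smul_eq_mul, mul_one,
    Pi.zero_apply] at e0 e1
  have hne : ι (omega d δ) - ι (conj (omega d δ)) ≠ 0 := by
    rw [← map_sub, h2]
    refine embedding_ne_zero ι fun h0 => ?_
    have := h.rat_add_mul_omega_eq_zero (x := -t) (y := 2) (by push_cast; linear_combination h0)
    norm_num at this
  have hy : y = 0 := by
    have : y * (ι (omega d δ) - ι (conj (omega d δ))) = 0 := by linear_combination e0 - e1
    exact (mul_eq_zero.1 this).resolve_right hne
  subst hy
  exact ⟨by simpa using e0, rfl⟩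

/-- The real basis given by the images of `1` and `ω`. -/
def realBasis (h : IsRealQuadratic d δ conj) (ι : K →+* ℝ) : Module.Basis (Fin 2) ℝ (Fin 2 → ℝ) :=
  basisOfLinearIndependentOfCardEqFinrank (h.linearIndependent_embed ι) (by simp)

theorem coe_realBasis (h : IsRealQuadratic d δ conj) (ι : K →+* ℝ) :
    ⇑(h.realBasis ι) = ![embed ι conj 1, embed ι conj (omega d δ)] := by simp [realBasis]

theorem embed_mem_span (h : IsRealQuadratic d δ conj) (ι : K →+* ℝ) {z : K} (hz : z ∈ h.order) :
    embed ι conj z ∈ Submodule.span ℤ (Set.range (h.realBasis ι)) := by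
  obtain ⟨a, b, rfl⟩ := hz
  have e : embed ι conj ((a : K) + (b : K) * omega d δ)
      = a • h.realBasis ι 0 + b • h.realBasis ι 1 := by
    rw [coe_realBasis, ← zsmul_one (R := K) a, ← zsmul_eq_mul, map_add, map_zsmul, map_zsmul]
    rfl
  rw [e]
  exact add_mem (Submodule.smul_mem _ _ (Submodule.subset_span ⟨0, rfl⟩))
    (Submodule.smul_mem _ _ (Submodule.subset_span ⟨1, rfl⟩))

theorem finite_arcSet (h : IsRealQuadratic d δ conj) (ι : K →+* ℝ) {X : Set K}
    (hX : X ⊆ h.order) (a b T : ℝ) : (arcSet ι conj X a b T).Finite := by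
  rw [arcSet_eq]
  refine Set.Finite.of_finite_image (f := embed ι conj) ?_ (embed_injective ι conj).injOn
  refine (ZSpan.setFinite_inter (h.realBasis ι) (isBounded_hyperbolicSector a b T)).subset ?_
  rintro _ ⟨z, hz, rfl⟩
  exact ⟨hz.2, h.embed_mem_span ι (hX hz.1)⟩

/-- Being contained in the order makes the image of Λ discrete; containing N times the order makes
it span the plane. So the count for plane lattices applies. -/
theorem exists_hasDensity_of_lattice (h : IsRealQuadratic d δ conj) (ι : K →+* ℝ)
    (Λ : AddSubgroup K) (hΛ : ∀ z ∈ Λ, z ∈ h.order) {N : ℕ} (hN : N ≠ 0)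
    (hΛN : ∀ z ∈ h.order, (N : K) * z ∈ Λ) : ∃ κ, 0 < κ ∧ HasDensity ι conj (Λ : Set K) κ := by
  set L : Submodule ℤ (Fin 2 → ℝ) := AddSubgroup.toIntSubmodule (Λ.map (embed ι conj)) with hL
  have hmem : ∀ v, v ∈ L ↔ ∃ z ∈ Λ, embed ι conj z = v := fun v => Iff.rfl
  have hdisc : DiscreteTopology L := by
    refine DiscreteTopology.of_subset (s := (Submodule.span ℤ (Set.range (h.realBasis ι)) :
      Set (Fin 2 → ℝ)))
      (inferInstanceAs (DiscreteTopology (Submodule.span ℤ (Set.range (h.realBasis ι))))) ?_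
    rintro _ ⟨z, hz, rfl⟩
    exact h.embed_mem_span ι (hΛ z hz)
  have hspan : ∀ z ∈ h.order, embed ι conj z ∈ Submodule.span ℝ (L : Set (Fin 2 → ℝ)) := by
    intro z hz
    have h1 : embed ι conj (N * z) ∈ Submodule.span ℝ (L : Set (Fin 2 → ℝ)) :=
      Submodule.subset_span ((hmem _).2 ⟨_, hΛN z hz, rfl⟩)
    have h2 : embed ι conj z = (N : ℝ)⁻¹ • embed ι conj (N * z) := by
      have : (N : ℝ) ≠ 0 := by exact_mod_cast hN
      rw [← nsmul_eq_mul, map_nsmul, ← Nat.cast_smul_eq_nsmul ℝ, smul_smul, inv_mul_cancel₀ this,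
        one_smul]
    rw [h2]
    exact Submodule.smul_mem _ _ h1
  have hlat : IsZLattice ℝ L := by
    refine ⟨?_⟩
    rw [eq_top_iff, ← (h.realBasis ι).span_eq, Submodule.span_le]
    rintro _ ⟨i, rfl⟩
    rw [coe_realBasis]
    fin_cases i
    · exact hspan 1 h.order.one_mem
    · exact hspan _ ⟨0, 1, by simp⟩
  obtain ⟨κ, hκ, hlim⟩ := exists_tendsto_card_hyperbolicSector_inter L
  refine ⟨κ, hκ, fun a b hab => (hlim a b hab).congr fun T => ?_⟩
  rw [arcSet_eq, ← Set.ncard_image_of_injective _ (embed_injective ι conj)]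
  congr 3
  ext v
  constructor
  · rintro ⟨h1, z, hz, rfl⟩
    exact ⟨z, ⟨hz, h1⟩, rfl⟩
  · rintro ⟨z, ⟨hz, h1⟩, rfl⟩
    exact ⟨h1, z, hz, rfl⟩

/-- The multiples of `k` in the order. -/
def multiples (h : IsRealQuadratic d δ conj) (k : ℕ) : AddSubgroup K :=
  h.order.toAddSubgroup.map (AddMonoidHom.mulLeft (k : K))

theorem mem_multiples (h : IsRealQuadratic d δ conj) {k : ℕ} {z : K} :
    z ∈ h.multiples k ↔ ∃ w ∈ h.order, k * w = z := Iff.rfl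

theorem multiples_le (h : IsRealQuadratic d δ conj) {k : ℕ} {z : K} (hz : z ∈ h.multiples k) :
    z ∈ h.order := by
  obtain ⟨w, hw, rfl⟩ := hz
  exact h.order.mul_mem (natCast_mem _ _) hw

theorem arcSet_multiples (h : IsRealQuadratic d δ conj) (ι : K →+* ℝ) {k : ℕ} (hk : k ≠ 0)
    (a b T : ℝ) : arcSet ι conj (h.multiples k) a b T
      = (fun z : K => (k : K) * z) '' arcSet ι conj (h.order : Set K) a b (T / k ^ 2) := by
  have hk0 : (k : K) ≠ 0 := by exact_mod_cast hk
  have hkR : (0 : ℝ) < k ^ 2 := by positivity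
  have key : ∀ w : K, w ≠ 0 → (logRatio ι conj (k * w) = logRatio ι conj w ∧
      realNorm ι conj (k * w) = k ^ 2 * realNorm ι conj w) := by
    intro w hw
    have hq := logRatio_rat ι conj (q := k) (by exact_mod_cast hk)
    rw [Rat.cast_natCast] at hq
    rw [logRatio_mul ι conj hk0 hw, hq, zero_add, realNorm_mul, realNorm_natCast]
    exact ⟨rfl, rfl⟩
  ext z
  constructor
  · rintro ⟨⟨w, hw, rfl⟩, h0, h1, h2⟩
    change (k : K) * w ≠ 0 at h0
    change logRatio ι conj (k * w) ∈ _ at h1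
    change realNorm ι conj (k * w) ≤ _ at h2
    have hw0 := right_ne_zero_of_mul h0
    rw [(key w hw0).1] at h1
    rw [(key w hw0).2] at h2
    exact ⟨w, ⟨hw, hw0, h1, by rw [le_div_iff₀ hkR]; linarith⟩, rfl⟩
  · rintro ⟨w, ⟨hw, hw0, h1, h2⟩, rfl⟩
    refine ⟨⟨w, hw, rfl⟩, mul_ne_zero hk0 hw0, ?_, ?_⟩
    · rw [(key w hw0).1]; exact h1
    · rw [le_div_iff₀ hkR] at h2
      rw [(key w hw0).2]; linarith

theorem ncard_arcSet_multiples (h : IsRealQuadratic d δ conj) (ι : K →+* ℝ) {k : ℕ} (hk : k ≠ 0)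
    (a b T : ℝ) : (arcSet ι conj (h.multiples k) a b T).ncard
      = (arcSet ι conj (h.order : Set K) a b (T / k ^ 2)).ncard := by
  have hk0 : (k : K) ≠ 0 := by exact_mod_cast hk
  rw [h.arcSet_multiples ι hk, Set.ncard_image_of_injective _ (mul_right_injective₀ hk0)]

theorem hasDensity_multiples (h : IsRealQuadratic d δ conj) {ι : K →+* ℝ} {κ : ℝ}
    (hκ : HasDensity ι conj (h.order : Set K) κ) {k : ℕ} (hk : k ≠ 0) :
    HasDensity ι conj (h.multiples k : Set K) (κ / k ^ 2) := by
  intro a b hab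
  have hkR : (0 : ℝ) < k ^ 2 := by positivity
  have h1 := ((hκ a b hab).comp (tendsto_id.atTop_div_const hkR)).div_const ((k : ℝ) ^ 2)
  rw [mul_div_right_comm] at h1
  refine h1.congr fun T => ?_
  rw [h.ncard_arcSet_multiples ι hk]
  simp only [Function.comp, id]
  rw [div_div, div_mul_cancel₀ _ hkR.ne']

/-- The domination needed for the Möbius sum: it must hold for every T ≥ 0, not only for large T.
Below T = 1 the set is empty, because nonzero elements have absolute norm at least one. -/
theorem exists_ncard_arcSet_le (h : IsRealQuadratic d δ conj) (ι : K →+* ℝ) (a b : ℝ)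
    (hab : a ≤ b) : ∃ C : ℝ, 0 ≤ C ∧ ∀ T : ℝ, 0 ≤ T →
      ((arcSet ι conj (h.order : Set K) a b T).ncard : ℝ) ≤ C * T := by
  obtain ⟨κ, hκ, hden⟩ := h.exists_hasDensity_of_lattice ι h.order.toAddSubgroup (fun _ hz => hz)
    one_ne_zero (fun z hz => by simpa using hz)
  obtain ⟨T₀, hT₀⟩ := eventually_atTop.1 ((hden a b hab).eventually_le_const
    (lt_add_one (κ * (b - a))))
  set B : ℝ := ((arcSet ι conj (h.order : Set K) a b T₀).ncard : ℝ)
  have hB : 0 ≤ B := Nat.cast_nonneg _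
  have hC : 0 ≤ κ * (b - a) + 1 := by
    have := mul_nonneg hκ.le (sub_nonneg.2 hab)
    positivity
  refine ⟨B + (κ * (b - a) + 1), by positivity, fun T hT => ?_⟩
  rcases lt_or_ge T 1 with h1 | h1
  · have : arcSet ι conj (h.order : Set K) a b T = ∅ := by
      rw [Set.eq_empty_iff_forall_notMem]
      rintro z ⟨hz, h0, -, h2⟩
      linarith [h.one_le_realNorm ι hz h0]
    rw [this, Set.ncard_empty]
    push_cast; positivity
  rcases le_total T₀ T with h2 | h2
  · have h3 := hT₀ T h2
    rw [div_le_iff₀ (by linarith)] at h3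
    exact h3.trans (mul_le_mul_of_nonneg_right (by linarith) hT)
  · have h3 : ((arcSet ι conj (h.order : Set K) a b T).ncard : ℝ) ≤ B :=
      Nat.cast_le.2 (Set.ncard_le_ncard (arcSet_mono ι conj subset_rfl le_rfl le_rfl h2)
        (h.finite_arcSet ι subset_rfl _ _ _))
    nlinarith

/-! ### Möbius inversion and the density of visible points -/

theorem sum_divisors_moebius (n : ℕ) :
    ∑ k ∈ n.divisors, ArithmeticFunction.moebius k = if n = 1 then 1 else 0 := by
  rw [← ArithmeticFunction.coe_mul_zeta_apply, ArithmeticFunction.moebius_mul_coe_zeta,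
    ArithmeticFunction.one_apply]

theorem ncard_visible_eq_tsum (h : IsRealQuadratic d δ conj) (ι : K →+* ℝ) {Λ : Set K}
    (hΛ : Λ ⊆ h.order) (a b T : ℝ) :
    ((arcSet ι conj (Λ ∩ visible d δ) a b T).ncard : ℝ)
      = ∑' k : ℕ, (ArithmeticFunction.moebius k : ℝ) *
        (arcSet ι conj (Λ ∩ h.multiples k) a b T).ncard := by
  classical
  have hfin := h.finite_arcSet ι hΛ a b T
  set F := hfin.toFinset with hF
  have hFm : ∀ z ∈ F, z ∈ h.order ∧ z ≠ 0 := fun z hz => by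
    rw [hF, Set.Finite.mem_toFinset] at hz
    exact ⟨hΛ hz.1, hz.2.1⟩
  have e1 : (arcSet ι conj (Λ ∩ visible d δ) a b T).ncard = #{z ∈ F | h.content z = 1} := by
    rw [← Set.ncard_coe_finset]
    congr 1
    ext z
    simp only [coe_filter, hF, Set.Finite.mem_toFinset, Set.mem_ofPred_eq]
    constructor
    · rintro ⟨⟨h1, h2⟩, h3⟩
      exact ⟨⟨h1, h3⟩, (h.mem_visible_iff.1 h2).2⟩
    · rintro ⟨⟨h1, h3⟩, h2⟩
      exact ⟨⟨h1, h.mem_visible_iff.2 ⟨hΛ h1, h2⟩⟩, h3⟩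
  have e2 : ∀ k : ℕ, (arcSet ι conj (Λ ∩ h.multiples k) a b T).ncard
      = #{z ∈ F | k ∣ h.content z} := by
    intro k
    rw [← Set.ncard_coe_finset]
    congr 1
    ext z
    simp only [coe_filter, hF, Set.Finite.mem_toFinset, Set.mem_ofPred_eq]
    constructor
    · rintro ⟨⟨h1, w, hw, e⟩, h3⟩
      exact ⟨⟨h1, h3⟩, (h.dvd_content (hΛ h1) k).2 ⟨w, hw, e.symm⟩⟩
    · rintro ⟨⟨h1, h3⟩, h2⟩
      obtain ⟨w, hw, e⟩ := (h.dvd_content (hΛ h1) k).1 h2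
      exact ⟨⟨h1, w, hw, e.symm⟩, h3⟩
  set B := ∑ z ∈ F, h.content z
  have hB : ∀ z ∈ F, h.content z ≤ B := fun z hz => single_le_sum (fun _ _ => Nat.zero_le _) hz
  -- Contents of the counted elements are positive and at most `B`, so no larger k divides any of
  -- them.
  rw [tsum_eq_sum (s := range (B + 1))]
  · simp_rw [e1, e2]
    have e3 : (#{z ∈ F | h.content z = 1} : ℤ)
        = ∑ k ∈ range (B + 1), ArithmeticFunction.moebius k * #{z ∈ F | k ∣ h.content z} := by
      simp_rw [card_filter]
      push_cast
      simp_rw [mul_sum]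
      rw [sum_comm]
      refine sum_congr rfl fun z hz => ?_
      have hc := h.content_pos (hFm z hz).1 (hFm z hz).2
      rw [← sum_divisors_moebius]
      simp_rw [mul_ite, mul_one, mul_zero]
      rw [← sum_filter]
      refine sum_congr ?_ fun _ _ => rfl
      ext k
      rw [Nat.mem_divisors, mem_filter, mem_range]
      refine ⟨fun hk => ⟨?_, hk.1⟩, fun hk => ⟨hk.2, hc.ne'⟩⟩
      have := Nat.le_of_dvd hc hk.1
      have := hB z hz
      omega
    exact_mod_cast e3
  · intro k hk
    rw [e2, filter_false_of_mem, card_empty, Nat.cast_zero, mul_zero]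
    intro z hz hdvd
    have := Nat.le_of_dvd (h.content_pos (hFm z hz).1 (hFm z hz).2) hdvd
    have := hB z hz
    rw [mem_range] at hk
    omega

/-- Dominated convergence exchanges the limit with the Möbius sum: the k-th term is at most C / k²,
since multiples of k with norm up to T correspond to elements with norm up to T / k². The value κ 0
is irrelevant, as μ(0) = 0. -/
theorem hasDensity_inter_visible (h : IsRealQuadratic d δ conj) (ι : K →+* ℝ) {Λ : Set K}
    (hΛ : Λ ⊆ h.order) {κ : ℕ → ℝ}
    (hκ : ∀ k ≠ 0, HasDensity ι conj (Λ ∩ h.multiples k) (κ k)) :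
    HasDensity ι conj (Λ ∩ visible d δ) (∑' k : ℕ, (ArithmeticFunction.moebius k : ℝ) * κ k) := by
  intro a b hab
  obtain ⟨C, hC, hbound⟩ := h.exists_ncard_arcSet_le ι a b hab
  rw [← tsum_mul_right]
  have hsum : Summable fun k : ℕ => C * (1 / (k : ℝ) ^ 2) :=
    (Real.summable_one_div_nat_pow.2 one_lt_two).mul_left C
  have := tendsto_tsum_of_dominated_convergence (𝓕 := atTop)
    (f := fun (T : ℝ) (k : ℕ) => (ArithmeticFunction.moebius k : ℝ) *
        (arcSet ι conj (Λ ∩ h.multiples k) a b T).ncard / T)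
    (g := fun k => (ArithmeticFunction.moebius k : ℝ) * κ k * (b - a)) hsum ?_ ?_
  · refine this.congr fun T => ?_
    rw [h.ncard_visible_eq_tsum ι hΛ, tsum_div_const]
  · intro k
    rcases eq_or_ne k 0 with rfl | hk
    · simp
    · have h1 := (hκ k hk a b hab).const_mul (ArithmeticFunction.moebius k : ℝ)
      rw [← mul_assoc] at h1
      exact h1.congr fun T => (mul_div_assoc _ _ _).symm
  · filter_upwards [eventually_gt_atTop 0] with T hT k
    rcases eq_or_ne k 0 with rfl | hk
    · simp
    have hμ : |(ArithmeticFunction.moebius k : ℝ)| ≤ 1 := by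
      exact_mod_cast ArithmeticFunction.abs_moebius_le_one
    have hle : ((arcSet ι conj (Λ ∩ h.multiples k) a b T).ncard : ℝ) ≤ C * (T / k ^ 2) := by
      refine le_trans ?_ (hbound (T / k ^ 2) (by positivity))
      rw [← h.ncard_arcSet_multiples ι hk]
      exact_mod_cast Set.ncard_le_ncard
        (arcSet_mono ι conj Set.inter_subset_right le_rfl le_rfl le_rfl)
        (h.finite_arcSet ι (fun z hz => h.multiples_le hz) _ _ _)
    rw [Real.norm_eq_abs, abs_div, abs_mul, Nat.abs_cast, abs_of_pos hT, div_le_iff₀ hT]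
    calc _ ≤ 1 * (C * (T / k ^ 2)) := by gcongr
      _ = _ := by ring

/-- The product of this sum with ζ(2) is 1. -/
theorem tsum_moebius_div_sq_ne_zero :
    ∑' k : ℕ, (ArithmeticFunction.moebius k : ℝ) * (1 / (k : ℝ) ^ 2) ≠ 0 := by
  intro h0
  have h1 := ArithmeticFunction.LSeries_zeta_mul_Lseries_moebius (s := 2) (by norm_num)
  have h2 : LSeries (fun n => ((ArithmeticFunction.moebius n : ℤ) : ℂ)) 2
      = ((∑' k : ℕ, (ArithmeticFunction.moebius k : ℝ) * (1 / (k : ℝ) ^ 2) : ℝ) : ℂ) := by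
    rw [LSeries, Complex.ofReal_tsum]
    refine tsum_congr fun k => ?_
    rcases eq_or_ne k 0 with rfl | hk
    · simp
    · rw [LSeries.term_of_ne_zero hk]
      push_cast
      rw [mul_one_div]
      norm_cast
  rw [h2, h0, Complex.ofReal_zero, mul_zero] at h1
  exact zero_ne_one h1

theorem exists_hasDensity_visible (h : IsRealQuadratic d δ conj) (ι : K →+* ℝ) :
    ∃ κ, 0 < κ ∧ HasDensity ι conj (visible d δ) κ := by
  obtain ⟨κ, hκ, hden⟩ := h.exists_hasDensity_of_lattice ι h.order.toAddSubgroup (fun _ hz => hz)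
    one_ne_zero (fun z hz => by simpa using hz)
  have h1 := h.hasDensity_inter_visible ι (Λ := h.order) subset_rfl (κ := fun k => κ / k ^ 2) (by
    intro k hk
    rw [Set.inter_eq_right.2 fun z hz => h.multiples_le hz]
    exact h.hasDensity_multiples hden hk)
  rw [Set.inter_eq_right.2 fun z hz => h.visible_subset_order hz] at h1
  refine ⟨_, h1.nonneg.lt_of_ne' ?_, h1⟩
  have e : ∀ k : ℕ, (ArithmeticFunction.moebius k : ℝ) * (κ / k ^ 2)
      = κ * ((ArithmeticFunction.moebius k : ℝ) * (1 / (k : ℝ) ^ 2)) := fun k => by ring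
  simp_rw [e]
  rw [tsum_mul_left]
  exact mul_ne_zero hκ.ne' tsum_moebius_div_sq_ne_zero

/-! ### Strata by the content of δα -/

/-- The visible points `α` for which `δ α` has content `c`. -/
def stratum (h : IsRealQuadratic d δ conj) (c : ℕ) : Set K :=
  {α ∈ visible d δ | h.content (δ * α) = c}

theorem stratum_subset_order (h : IsRealQuadratic d δ conj) (c : ℕ) :
    h.stratum c ⊆ h.order := fun _ hz => h.visible_subset_order hz.1

/-- The elements `z` of the order for which `c` divides `δ z`. -/
def divLattice (h : IsRealQuadratic d δ conj) (c : ℕ) : AddSubgroup K :=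
  h.order.toAddSubgroup ⊓ (h.multiples c).comap (AddMonoidHom.mulLeft δ)

theorem exists_hasDensity_divLattice_inter_visible (h : IsRealQuadratic d δ conj) (ι : K →+* ℝ)
    {c : ℕ} (hc : c ≠ 0) : ∃ κ, HasDensity ι conj ((h.divLattice c : Set K) ∩ visible d δ) κ := by
  have h1 : ∀ k : ℕ, k ≠ 0 → ∃ κ, HasDensity ι conj ((h.divLattice c : Set K) ∩ h.multiples k) κ := by
    intro k hk
    obtain ⟨κ, -, hκ⟩ := h.exists_hasDensity_of_lattice ι (h.divLattice c ⊓ h.multiples k)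
      -- Both conditions hold on ck times the order.
      (fun z hz => hz.1.1) (mul_ne_zero hc hk) (fun z hz => by
        refine ⟨⟨h.order.mul_mem (natCast_mem _ _) hz, ?_⟩, ?_⟩
        · exact h.mem_multiples.2 ⟨δ * (k * z), h.order.mul_mem h.delta_mem
            (h.order.mul_mem (natCast_mem _ _) hz), by
              change _ = δ * _
              push_cast; ring⟩
        · exact h.mem_multiples.2 ⟨c * z, h.order.mul_mem (natCast_mem _ _) hz, by push_cast; ring⟩)
    exact ⟨κ, hκ⟩
  choose! κ hκ using h1
  exact ⟨_, h.hasDensity_inter_visible ι (fun z hz => hz.1) hκ⟩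

theorem mem_divLattice_iff (h : IsRealQuadratic d δ conj) {c : ℕ} {α : K}
    (hα : α ∈ visible d δ) : α ∈ h.divLattice c ↔ c ∣ h.content (δ * α) := by
  have hm := h.visible_subset_order hα
  rw [h.dvd_content (h.order.mul_mem h.delta_mem hm)]
  constructor
  · rintro ⟨-, w, hw, e⟩
    exact ⟨w, hw, e.symm⟩
  · rintro ⟨w, hw, e⟩
    exact ⟨hm, w, hw, e.symm⟩

/-- Decomposition of a set of visible points according to the content of `δ α`. -/
theorem ncard_eq_sum_stratum (h : IsRealQuadratic d δ conj) (ι : K →+* ℝ) (p : ℕ → Prop)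
    [DecidablePred p] (T : ℕ → ℝ) (a b : ℝ) :
    {α | α ∈ visible d δ ∧ p (h.content (δ * α)) ∧ logRatio ι conj α ∈ Set.Ico a b ∧
        realNorm ι conj α ≤ T (h.content (δ * α))}.ncard
      = ∑ c ∈ d.divisors with p c, (arcSet ι conj (h.stratum c) a b (T c)).ncard := by
  classical
  have hfin : ∀ c, (arcSet ι conj (h.stratum c) a b (T c)).Finite := fun c =>
    h.finite_arcSet ι (h.stratum_subset_order c) _ _ _
  have hset : {α | α ∈ visible d δ ∧ p (h.content (δ * α)) ∧ logRatio ι conj α ∈ Set.Ico a b ∧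
        realNorm ι conj α ≤ T (h.content (δ * α))}
      = (({c ∈ d.divisors | p c}.biUnion fun c => (hfin c).toFinset : Finset K) : Set K) := by
    ext α
    simp only [Set.mem_ofPred_eq, coe_biUnion, Set.mem_iUnion, Set.Finite.coe_toFinset, mem_coe,
      mem_filter, Nat.mem_divisors]
    constructor
    · rintro ⟨h1, h2, h3, h4⟩
      exact ⟨_, ⟨⟨h.content_delta_mul_dvd h1, by have := h.one_lt; omega⟩, h2⟩, ⟨h1, rfl⟩,
        h.visible_ne_zero h1, h3, h4⟩
    · rintro ⟨c, ⟨-, h2⟩, ⟨h1, rfl⟩, -, h3, h4⟩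
      exact ⟨h1, h2, h3, h4⟩
  rw [hset, Set.ncard_coe_finset, card_biUnion]
  · refine sum_congr rfl fun c _ => ?_
    rw [← Set.ncard_coe_finset, Set.Finite.coe_toFinset]
  · intro c _ c' _ hcc
    rw [Function.onFun, Finset.disjoint_left]
    intro α h1 h2
    rw [Set.Finite.mem_toFinset] at h1 h2
    exact hcc (h1.1.2.symm.trans h2.1.2)

/-- The visible points in `h.divLattice c` are the disjoint union of the strata of the e with c | e
| d. Downward induction on c subtracts the strata with e ≠ c. -/
theorem exists_hasDensity_stratum (h : IsRealQuadratic d δ conj) (ι : K →+* ℝ) (c : ℕ)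
    (hc : c ∈ d.divisors) : ∃ κ, HasDensity ι conj (h.stratum c) κ := by
  induction hm : d - c using Nat.strong_induction_on generalizing c with
  | _ m ih =>
  subst hm
  rw [Nat.mem_divisors] at hc
  have hc0 : c ≠ 0 := fun h0 => hc.2 (by rw [h0] at hc; exact zero_dvd_iff.1 hc.1)
  have hstep : ∀ e ∈ ({e ∈ d.divisors | c ∣ e}.erase c), ∃ κ, HasDensity ι conj (h.stratum e) κ := by
    intro e he
    rw [mem_erase, mem_filter, Nat.mem_divisors] at he
    obtain ⟨hec, ⟨hed, hd0⟩, hce⟩ := he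
    have h1 : e ≤ d := Nat.le_of_dvd (Nat.pos_of_ne_zero hd0) hed
    have h2 : c ≤ e := Nat.le_of_dvd (Nat.pos_of_ne_zero fun h0 => by
      rw [h0] at hed; exact hd0 (zero_dvd_iff.1 hed)) hce
    exact ih (d - e) (by omega) e (Nat.mem_divisors.2 ⟨hed, hd0⟩) rfl
  choose! κ hκ using hstep
  obtain ⟨κ₀, hκ₀⟩ := h.exists_hasDensity_divLattice_inter_visible ι hc0
  refine ⟨κ₀ - ∑ e ∈ {e ∈ d.divisors | c ∣ e}.erase c, κ e, fun a b hab => ?_⟩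
  have h1 := (hκ₀ a b hab).sub (tendsto_finsetSum _ fun e he => hκ e he a b hab)
  rw [← sum_mul, ← sub_mul] at h1
  refine h1.congr fun T => ?_
  have h2 := h.ncard_eq_sum_stratum ι (fun e => c ∣ e) (fun _ => T) a b
  have h3 : {α | α ∈ visible d δ ∧ c ∣ h.content (δ * α) ∧ logRatio ι conj α ∈ Set.Ico a b ∧
        realNorm ι conj α ≤ T} = arcSet ι conj ((h.divLattice c : Set K) ∩ visible d δ) a b T := by
    ext α
    constructor
    · rintro ⟨h1, h2, h3⟩
      exact ⟨⟨(h.mem_divLattice_iff h1).2 h2, h1⟩, h.visible_ne_zero h1, h3⟩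
    · rintro ⟨⟨h2, h1⟩, -, h3⟩
      exact ⟨h1, (h.mem_divLattice_iff h1).1 h2, h3⟩
  rw [h3, ← add_sum_erase _ _ (mem_filter.2 ⟨Nat.mem_divisors.2 hc, dvd_rfl⟩)] at h2
  rw [h2]
  push_cast
  rw [add_div, sum_div, add_sub_cancel_right]

/-- The strata partition the visible points, so their densities add up to a positive number.
Positivity of each one is not needed. -/
theorem exists_hasDensity_stratum_pos (h : IsRealQuadratic d δ conj) (ι : K →+* ℝ) :
    ∃ κ : ℕ → ℝ, (∀ c ∈ d.divisors, HasDensity ι conj (h.stratum c) (κ c)) ∧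
      0 < ∑ c ∈ d.divisors, κ c := by
  have h1 := fun c hc => h.exists_hasDensity_stratum ι c hc
  choose! κ hκ using h1
  refine ⟨κ, hκ, ?_⟩
  obtain ⟨κ₀, hpos, hκ₀⟩ := h.exists_hasDensity_visible ι
  have h2 : HasDensity ι conj (visible d δ) (∑ c ∈ d.divisors, κ c) := by
    intro a b hab
    have h3 := tendsto_finsetSum d.divisors fun c hc => hκ c hc a b hab
    rw [← sum_mul] at h3
    refine h3.congr fun T => ?_
    have h4 := h.ncard_eq_sum_stratum ι (fun _ => True) (fun _ => T) a b
    have h5 : {α | α ∈ visible d δ ∧ True ∧ logRatio ι conj α ∈ Set.Ico a b ∧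
        realNorm ι conj α ≤ T} = arcSet ι conj (visible d δ) a b T := by
      ext α
      exact ⟨fun h6 => ⟨h6.1, h.visible_ne_zero h6.1, h6.2.2⟩, fun h6 => ⟨h6.1, trivial, h6.2.2⟩⟩
    rw [h5, filter_true] at h4
    rw [h4, Nat.cast_sum, sum_div]
  rwa [h2.unique hκ₀]

/-! ### Counting by M and the conclusion -/

/-- The visible points `α` with `log |α / ᾱ| ∈ [a, b)` over points `ξ` with `M(ξ) ≤ t`. -/
def heightSet (h : IsRealQuadratic d δ conj) (ι : K →+* ℝ) (a b t : ℝ) : Set K :=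
  {α | α ∈ visible d δ ∧ logRatio ι conj α ∈ Set.Ico a b ∧
    realNorm ι conj α * √d / h.content (δ * α) ≤ t}

theorem heightSet_eq (h : IsRealQuadratic d δ conj) (ι : K →+* ℝ) (a b t : ℝ) :
    h.heightSet ι a b t = {α | α ∈ visible d δ ∧ True ∧ logRatio ι conj α ∈ Set.Ico a b ∧
      realNorm ι conj α ≤ t * (h.content (δ * α) / √d)} := by
  have hd : 0 < √(d : ℝ) := Real.sqrt_pos.2 (by have := h.one_lt; positivity)
  ext α
  refine and_congr_right fun hα => ?_
  have hc : (0 : ℝ) < h.content (δ * α) := by exact_mod_cast h.content_delta_mul_pos hα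
  rw [true_and]
  refine and_congr_right fun _ => ?_
  rw [div_le_iff₀ hc, ← mul_div_assoc, le_div_iff₀ hd]

theorem finite_heightSet (h : IsRealQuadratic d δ conj) (ι : K →+* ℝ) (a b t : ℝ) (ht : 0 ≤ t) :
    (h.heightSet ι a b t).Finite := by
  rw [heightSet_eq]
  refine (h.finite_arcSet ι (X := h.order) subset_rfl a b (t * (d / √d))).subset ?_
  rintro α ⟨h1, -, h2, h3⟩
  have hle : (h.content (δ * α) : ℝ) ≤ d := by
    exact_mod_cast Nat.le_of_dvd (by have := h.one_lt; omega) (h.content_delta_mul_dvd h1)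
  refine ⟨h.visible_subset_order h1, h.visible_ne_zero h1, h2, h3.trans ?_⟩
  gcongr

/-- On the stratum c the condition on M reads |N(α)| ≤ tc / √d, so that stratum contributes its
density times c / √d. The weights are positive and some density is positive. -/
theorem exists_tendsto_ncard_heightSet (h : IsRealQuadratic d δ conj) (ι : K →+* ℝ) :
    ∃ κ : ℝ, 0 < κ ∧ ∀ a b : ℝ, a ≤ b →
      Tendsto (fun t : ℝ => ((h.heightSet ι a b t).ncard : ℝ) / t) atTop (𝓝 (κ * (b - a))) := by
  obtain ⟨κ, hκ, hpos⟩ := h.exists_hasDensity_stratum_pos ι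
  have hd : 0 < √(d : ℝ) := Real.sqrt_pos.2 (by have := h.one_lt; positivity)
  have hc : ∀ c ∈ d.divisors, (0 : ℝ) < c / √d := fun c hc => by
    have := Nat.pos_of_mem_divisors hc
    positivity
  refine ⟨∑ c ∈ d.divisors, κ c * (c / √d), ?_, fun a b hab => ?_⟩
  · obtain ⟨c, hcd, hcpos⟩ := exists_lt_of_sum_lt (s := d.divisors) (f := fun _ => (0 : ℝ))
      (by simpa using hpos)
    exact sum_pos' (fun e he => mul_nonneg (hκ e he).nonneg (hc e he).le)
      ⟨c, hcd, mul_pos hcpos (hc c hcd)⟩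
  · rw [sum_mul]
    have h1 : ∀ c ∈ d.divisors, Tendsto (fun t : ℝ =>
        ((arcSet ι conj (h.stratum c) a b (t * (c / √d))).ncard : ℝ) / t) atTop
        (𝓝 (κ c * (c / √d) * (b - a))) := by
      intro c hcd
      have h2 := ((hκ c hcd a b hab).comp
        (tendsto_id.atTop_mul_const (hc c hcd))).mul_const ((c : ℝ) / √d)
      rw [mul_right_comm] at h2
      refine h2.congr fun t => ?_
      simp only [Function.comp, id]
      rw [← div_div, div_mul_cancel₀ _ (hc c hcd).ne']
    refine (tendsto_finsetSum _ h1).congr fun t => ?_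
    rw [heightSet_eq, h.ncard_eq_sum_stratum ι (fun _ => True) (fun c => t * (c / √d)) a b,
      filter_true, Nat.cast_sum, sum_div]

theorem isEquidistributed_MSet (h : IsRealQuadratic d δ conj) (ι : K →+* ℝ) {ε : (𝓞 K)ˣ}
    (hε : IsFundamentalUnit ε) :
    IsEquidistributed (fun n : ℕ => MSet d δ conj ι ε (n : ℝ)) := by
  classical
  have hp := abs_pos.2 (h.period_ne_zero ι hε)
  set p := |period ι ε| with hpdef
  -- The sign of the period does not affect the circle.
  have hH : AddSubgroup.zmultiples (period ι ε) = AddSubgroup.zmultiples p := by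
    rcases abs_choice (period ι ε) with h1 | h1
    · rw [hpdef, h1]
    · rw [hpdef, h1, AddSubgroup.zmultiples_neg]
  have hfin : ∀ n : ℕ, (h.heightSet ι 0 p n).Finite := fun n =>
    h.finite_heightSet ι 0 p n n.cast_nonneg
  have hM : ∀ α ∈ visible d δ, M d δ conj ι ε (logRatio ι conj α : ℝ)
      = realNorm ι conj α * √d / h.content (δ * α) := fun α hα => by
    rw [h.M_eq_pairNorm ι ε hα, h.pairNorm_dual ι hα]
  obtain ⟨κ, hκ, hlim⟩ := h.exists_tendsto_ncard_heightSet ι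
  refine isEquidistributed_of_fibers _ hp hH _
    (fun m n hmn ξ hξ => ⟨hξ.1, hξ.2.trans (by exact_mod_cast hmn)⟩)
    (fun n => (hfin n).toFinset) (logRatio ι conj)
    (fun n α hα => ((hfin n).mem_toFinset.1 hα).2.1) ?_ 4 four_ne_zero ?_ ?_
  · intro a b ha hab hb
    have hnum : ∀ n : ℕ, #{α ∈ (hfin n).toFinset | logRatio ι conj α ∈ Set.Ico a b}
        = (h.heightSet ι a b n).ncard := by
      intro n
      rw [← Set.ncard_coe_finset]
      congr 1
      ext α
      simp only [coe_filter, Set.Finite.mem_toFinset, Set.mem_ofPred_eq]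
      constructor
      · rintro ⟨⟨h1, -, h2⟩, h3⟩
        exact ⟨h1, h3, h2⟩
      · rintro ⟨h1, h3, h2⟩
        exact ⟨⟨h1, ⟨ha.trans h3.1, h3.2.trans_le hb⟩, h2⟩, h3⟩
    have hden : ∀ n : ℕ, #(hfin n).toFinset = (h.heightSet ι 0 p n).ncard := fun n =>
      (Set.ncard_eq_toFinset_card _ (hfin n)).symm
    -- The factor κ cancels in the quotient of the two asymptotics, leaving (b - a) / p.
    have h1 := ((hlim a b hab).div (hlim 0 p hp.le) (by
      rw [sub_zero]; exact (mul_pos hκ hp).ne')).comp tendsto_natCast_atTop_atTop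
    rw [sub_zero, mul_div_mul_left _ _ hκ.ne'] at h1
    refine h1.congr' ?_
    filter_upwards [eventually_gt_atTop 0] with n hn
    have hn' : (n : ℝ) ≠ 0 := by positivity
    simp only [Function.comp, Pi.div_apply]
    rw [hnum, hden, div_div_div_cancel_right₀ hn']
  · intro n α hα
    obtain ⟨h1, -, h2⟩ := (hfin n).mem_toFinset.1 hα
    refine ⟨⟨piMap conj α, h.piMap_mem_normOne (h.visible_ne_zero h1), phi_piMap _ _ _ _⟩, ?_⟩
    exact (hM α h1).le.trans h2
  -- The bound defining `h.heightSet` depends only on ξ, so all four points of the fibre satisfy it.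
  · rintro n ξ ⟨hξ, hξn⟩
    rw [← h.ncard_fiber ι hε hξ]
    congr 1
    ext α
    simp only [Set.Finite.mem_toFinset, Set.mem_ofPred_eq]
    constructor
    · rintro ⟨⟨h1, h2, -⟩, h3⟩
      exact ⟨h1, h2, h3⟩
    · rintro ⟨h1, h2, h3⟩
      refine ⟨⟨h1, h2, ?_⟩, h3⟩
      rw [← hM α h1]
      exact (congrArg _ h3).trans_le hξn

end IsRealQuadratic
end RealQuadratic

end

theorem mainTheorem3 {K : Type*} [Field K] [NumberField K]
    (hK : Module.finrank ℚ K = 2)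
    -- `K = ℚ(√d)` with `d > 1` square-free, `δ = √d`, and `ι` embeds `K` in `ℝ`
    (d : ℕ) (hd : Squarefree d) (hd1 : 1 < d) (δ : K) (hδ : δ ^ 2 = (d : K)) (ι : K →+* ℝ)
    -- the conjugation of `K`
    (conj : K ≃ₐ[ℚ] K) (hconj : conj δ = -δ)
    (ε : (𝓞 K)ˣ) (hε : RealQuadratic.IsFundamentalUnit ε) :
    -- `M` is well defined on `φ(𝒩)`
    (∀ ξ ∈ RealQuadratic.phi ι ε '' RealQuadratic.normOne K,
      (∃ α α' : K, RealQuadratic.IsPreimagePair d δ conj ι ε ξ α α') ∧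
      ∀ α α' : K, RealQuadratic.IsPreimagePair d δ conj ι ε ξ α α' →
        RealQuadratic.M d δ conj ι ε ξ = RealQuadratic.pairNorm α α') ∧
    -- `ℳ(1) ⊆ ℳ(2) ⊆ ⋯` is equidistributed in `𝕊`
    IsEquidistributed (fun n : ℕ => RealQuadratic.MSet d δ conj ι ε (n : ℝ)) := by
  have h : RealQuadratic.IsRealQuadratic d δ conj := ⟨hK, hd, hd1, hδ, hconj⟩
  exact ⟨fun ξ hξ => h.M_well_defined ι ε hξ, h.isEquidistributed_MSet ι hε⟩
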